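/- A braced polygon graph is a finite simple graph $P$ with vertices $1,\dots,n$ ($n\ge 3$) that contains the Hamilton cycle $1,2,\dots,n,1$; the edges of this cycle are called boundary edges and all other edges are called braces. A strictly convex realisation of $P$ is a configuration $\mathbf p=(p_1,\dots,p_n)$ of points of $\mathbb R^2$ that are, in this cyclic order, the vertices of a strictly convex polygon (a convex polygon each of whose vertices lies on a line meeting the polygon only at that vertex). An equilibrium stress of $(P,\mathbf p)$ is a function $\omega:E(P)\to\mathbb R$ such that $\sum_{j:\,ij\in E(P)}\omega_{ij}(p_i-p_j)=0$ for every vertex $i$. It is proper if it is positive on every boundary edge and negative on every brace, and the realisation is properly stressed if it has a proper equilibrium stress. A graph is $3$-connected if it has at least four vertices and remains connected after the removal of any set of at most two vertices. Theorem. Every $3$-connected braced polygon graph $P$ has a strictly convex realisation that is properly stressed. In addition, if $B$ is a set of braces of $P$ such that $P-B$ is $3$-connected, then there are a strictly convex realisation $\mathbf p$ of $P$ and an equilibrium stress $\omega$ of $(P,\mathbf p)$ that is positive on every boundary edge, negative on every brace not in $B$, and positive on every brace in $B$. -/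

import Mathlib

/-- A graph is `k`-connected if it has more than `k` vertices and it stays connected after
the removal of any set of fewer than `k` vertices. -/
def IsKConnected {V : Type*} [Fintype V] (k : ℕ) (G : SimpleGraph V) : Prop :=
  k < Fintype.card V ∧
    ∀ S : Finset V, S.card < k → (G.induce {v | v ∉ S}).Connected

/-- A braced polygon graph on the cyclically ordered vertices `0, 1, …, n - 1`: a graph that
contains the Hamilton cycle joining each vertex to the next one modulo `n`. -/
structure BracedPolygonGraph (n : ℕ) where
  /-- The underlying graph. -/
  graph : SimpleGraph (Fin n)
  /-- A polygon has at least three vertices. -/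
  three_le : 3 ≤ n
  /-- Consecutive vertices are joined. -/
  cycle_le : SimpleGraph.cycleGraph n ≤ graph

namespace BracedPolygonGraph

variable {n : ℕ}

/-- The boundary edges: the edges of the distinguished Hamilton cycle. -/
def boundaryEdges (_P : BracedPolygonGraph n) : Set (Sym2 (Fin n)) :=
  (SimpleGraph.cycleGraph n).edgeSet

/-- The braces (interior edges): the edges that are not boundary edges. -/
def braces (P : BracedPolygonGraph n) : Set (Sym2 (Fin n)) :=
  P.graph.edgeSet \ P.boundaryEdges

/-- The braced polygon graph `P - B`, for a set `B` of braces of `P`. -/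
def deleteBraces (P : BracedPolygonGraph n) (B : Set (Sym2 (Fin n))) (hB : B ⊆ P.braces) :
    BracedPolygonGraph n where
  graph := P.graph.deleteEdges B
  three_le := P.three_le
  cycle_le := fun i j hij => by
    rw [SimpleGraph.deleteEdges_adj]
    exact ⟨P.cycle_le hij, fun h => (hB h).2 hij⟩

end BracedPolygonGraph

/-- The points `p 0, …, p (n - 1)` are, in this cyclic order, the vertices of a strictly convex
polygon: they are distinct, each of them lies on a line that meets the polygon (the convex hull of
the points) only there and has the polygon on one side, and each segment between consecutive
points lies on the boundary of the polygon. -/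
structure IsStrictlyConvexPolygon {n : ℕ} (p : Fin n → EuclideanSpace ℝ (Fin 2)) : Prop where
  injective : Function.Injective p
  vertex : ∀ i, p i ∈ Set.exposedPoints ℝ (convexHull ℝ (Set.range p))
  edge : ∀ i j, (SimpleGraph.cycleGraph n).Adj i j →
    segment ℝ (p i) (p j) ⊆ frontier (convexHull ℝ (Set.range p))

/-- `ω` is an equilibrium stress of the planar framework `(G, p)`. A stress is a real function on
the edges of `G`; it is extended by zero to all unordered pairs. -/
structure IsEquilibriumStress {n : ℕ} (G : SimpleGraph (Fin n))
    (p : Fin n → EuclideanSpace ℝ (Fin 2)) (ω : Sym2 (Fin n) → ℝ) : Prop where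
  zero_off_edges : ∀ e, e ∉ G.edgeSet → ω e = 0
  equilibrium : ∀ i, ∑ j, ω s(i, j) • (p i - p j) = 0

namespace BracedPolygonGraph

variable {n : ℕ}

/-- `ω` has the signs of a proper stress on the edges of `P`: positive on the boundary edges and
negative on the braces. -/
def HasProperSigns (P : BracedPolygonGraph n) (ω : Sym2 (Fin n) → ℝ) : Prop :=
  (∀ e ∈ P.boundaryEdges, 0 < ω e) ∧ ∀ e ∈ P.braces, ω e < 0

/-- The realisation `p` of `P` is properly stressed: it has an equilibrium stress that is positive
on the boundary edges and negative on the braces. -/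
def IsProperlyStressed (P : BracedPolygonGraph n) (p : Fin n → EuclideanSpace ℝ (Fin 2)) : Prop :=
  ∃ ω : Sym2 (Fin n) → ℝ, IsEquilibriumStress P.graph p ω ∧ P.HasProperSigns ω

end BracedPolygonGraph

/-!
The realisation is found by maximising an energy. Fix the lengths of the boundary edges: the
vertices `0, …, M` are joined by a chain of `M` unit edges, and the base, from `0` to `M`, has
length `M - 1/2`. The space `chainSpace M` of convex chains with this base is compact, and in it
the directions of the edges are increasing and span less than a half turn. Let `θ` be a chain at
which the sum of the squared lengths of the braces is maximal.

The chain `θ` is strictly convex (`strictMono_of_isMaxOn_chainEnergy`). Otherwise it has straight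
runs of several edges. Bend all of them outwards at once, each with the velocity profile
`(m - a) * (b - m)` of a parabola over its end vertices `a` and `b`. To first order this keeps the
edge lengths and the base, and it moves no vertex towards another one joined to it by a brace. As
`a` and `b` do not separate the graph, some brace joins an interior vertex of the run to a vertex
off its line, and this brace gets longer to first order. The implicit function theorem turns the
motion into a path of convex chains (`deriv_nonpos_of_isMaxOn`), which contradicts maximality.

At a strictly convex maximiser the convexity constraints are inactive, so the forces of the braces
are balanced by Lagrange multipliers of the edge lengths, which are a stress on the boundary edges
(`exists_cycleStress_of_isMaxOn`). At each vertex the braces push into the angle opposite to the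
angle of the polygon, and there is at least one brace, so the stress of both boundary edges is
positive (`cycleStress_pos`).

For the signs on `B`, the braces in `B` enter the energy with a small negative weight `-η`. As `η`
tends to zero the maximisers accumulate at a maximiser for `P - B`. Strict convexity and the
direction of the forces are open conditions, so they persist for small `η`
(`exists_isMaxOn_perturbedWeights`). The case of proper stresses is the one of empty `B`.
-/

/-! ### Orientation of triples and strictly convex polygons -/

/-- The adjacency of the Hamilton cycle, read off from the values of the vertices. -/
theorem cycleGraph_adj_iff_val {M : ℕ} (hM : 2 ≤ M) (i j : Fin (M + 1)) :
    (SimpleGraph.cycleGraph (M + 1)).Adj i j ↔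
      (j : ℕ) = i + 1 ∨ (i : ℕ) = j + 1 ∨ ((i : ℕ) = 0 ∧ (j : ℕ) = M) ∨
        ((i : ℕ) = M ∧ (j : ℕ) = 0) := by
  have hi := i.isLt
  have hj := j.isLt
  rw [SimpleGraph.cycleGraph_adj']
  rcases le_total i j with h | h
  · rcases eq_or_lt_of_le h with rfl | h'
    · simp only [sub_self, Fin.val_zero]
      omega
    · rw [Fin.coe_sub_iff_le.2 h, Fin.coe_sub_iff_lt.2 h']
      have : (i : ℕ) < j := h'
      omega
  · rcases eq_or_lt_of_le h with rfl | h'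
    · simp only [sub_self, Fin.val_zero]
      omega
    · rw [Fin.coe_sub_iff_le.2 h, Fin.coe_sub_iff_lt.2 h']
      have : (j : ℕ) < i := h'
      omega

/-- Every vertex has two distinct neighbours on the Hamilton cycle, and no other ones. -/
theorem exists_cycleGraph_neighbours {M : ℕ} (hM : 2 ≤ M) (i : Fin (M + 1)) :
    ∃ a b : Fin (M + 1), a ≠ b ∧ (SimpleGraph.cycleGraph (M + 1)).Adj i a ∧
      (SimpleGraph.cycleGraph (M + 1)).Adj i b ∧
      ∀ c, (SimpleGraph.cycleGraph (M + 1)).Adj i c → c = a ∨ c = b := by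
  have hi := i.isLt
  simp only [cycleGraph_adj_iff_val hM, ne_eq, Fin.ext_iff]
  rcases Nat.eq_zero_or_pos (i : ℕ) with h0 | h0
  · refine ⟨⟨1, by omega⟩, ⟨M, by omega⟩, ?_, ?_, ?_, fun c hc => ?_⟩ <;> dsimp only at *
    any_goals omega
  rcases Nat.lt_or_ge (i : ℕ) M with h1 | h1
  · refine ⟨⟨i + 1, by omega⟩, ⟨i - 1, by omega⟩, ?_, ?_, ?_, fun c hc => ?_⟩ <;> dsimp only at *
    any_goals omega
  · refine ⟨⟨0, by omega⟩, ⟨M - 1, by omega⟩, ?_, ?_, ?_, fun c hc => ?_⟩ <;> dsimp only at *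
    any_goals omega

/-- Twice the signed area of the triangle `a b c`. -/
def orient (a b c : EuclideanSpace ℝ (Fin 2)) : ℝ :=
  (b 0 - a 0) * (c 1 - a 1) - (b 1 - a 1) * (c 0 - a 0)

/-- The line through two consecutive vertices has all other vertices on the same side, which is
recorded by the sign `s`. -/
theorem exists_sign_of_orient_pos {M : ℕ} (hM : 2 ≤ M)
    {p : Fin (M + 1) → EuclideanSpace ℝ (Fin 2)}
    (hp : ∀ i j k : Fin (M + 1), i < j → j < k → 0 < orient (p i) (p j) (p k))
    {i j : Fin (M + 1)} (hij : (SimpleGraph.cycleGraph (M + 1)).Adj i j) :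
    ∃ s : ℝ, ∀ k, k ≠ i → k ≠ j → 0 < s * orient (p i) (p j) (p k) := by
  rw [cycleGraph_adj_iff_val hM] at hij
  have hi := i.isLt
  have hj := j.isLt
  have key : ∀ k : Fin (M + 1), k ≠ i → k ≠ j → (k : ℕ) ≠ i ∧ (k : ℕ) ≠ j :=
    fun k h1 h2 => ⟨fun h => h1 (Fin.ext h), fun h => h2 (Fin.ext h)⟩
  rcases hij with h | h | ⟨h, h'⟩ | ⟨h, h'⟩
  · refine ⟨1, fun k hki hkj => ?_⟩
    obtain ⟨h1, h2⟩ := key k hki hkj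
    rcases lt_or_gt_of_ne h1 with h3 | h3
    · have := hp k i j (by omega) (by omega)
      simp only [orient] at this ⊢
      linarith
    · have := hp i j k (by omega) (by omega)
      linarith
  · refine ⟨-1, fun k hki hkj => ?_⟩
    obtain ⟨h1, h2⟩ := key k hki hkj
    rcases lt_or_gt_of_ne h1 with h3 | h3
    · have := hp k j i (by omega) (by omega)
      simp only [orient] at this ⊢
      linarith
    · have := hp j i k (by omega) (by omega)
      simp only [orient] at this ⊢
      linarith
  · refine ⟨-1, fun k hki hkj => ?_⟩
    obtain ⟨h1, h2⟩ := key k hki hkj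
    have := hp i k j (by omega) (by omega)
    simp only [orient] at this ⊢
    linarith
  · refine ⟨1, fun k hki hkj => ?_⟩
    obtain ⟨h1, h2⟩ := key k hki hkj
    have := hp j k i (by omega) (by omega)
    simp only [orient] at this ⊢
    linarith

/-- The linear part of the affine function `orient a b`. -/
noncomputable def orientCLM (a b : EuclideanSpace ℝ (Fin 2)) :
    EuclideanSpace ℝ (Fin 2) →L[ℝ] ℝ :=
  (b 0 - a 0) • EuclideanSpace.proj 1 - (b 1 - a 1) • EuclideanSpace.proj 0

theorem orientCLM_sub (a b x y : EuclideanSpace ℝ (Fin 2)) :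
    orientCLM a b x - orientCLM a b y = orient a b x - orient a b y := by
  simp [orientCLM, orient]
  ring

theorem orient_self_left (a b : EuclideanSpace ℝ (Fin 2)) : orient a b a = 0 := by
  simp [orient]

theorem orient_self_right (a b : EuclideanSpace ℝ (Fin 2)) : orient a b b = 0 := by
  simp only [orient]; ring

/-- A vertex is exposed when a linear functional is strictly larger there than at all other
vertices. -/
theorem mem_exposedPoints_convexHull_range {ι E : Type*} [AddCommGroup E] [Module ℝ E]
    [TopologicalSpace E] {p : ι → E} {i : ι} (l : StrongDual ℝ E)
    (hl : ∀ k, k ≠ i → l (p k) < l (p i)) :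
    p i ∈ Set.exposedPoints ℝ (convexHull ℝ (Set.range p)) := by
  have hconv : Convex ℝ {y | y = p i ∨ l y < l (p i)} := by
    rw [convex_iff_forall_pos]
    intro x hx y hy a b ha hb hab
    have e1 : l (p i) = a * l (p i) + b * l (p i) := by rw [← add_mul, hab, one_mul]
    rcases hx with rfl | hx <;> rcases hy with rfl | hy
    · left
      rw [← add_smul, hab, one_smul]
    · right
      simp only [map_add, map_smul, smul_eq_mul]
      have := mul_lt_mul_of_pos_left hy hb
      linarith
    · right
      simp only [map_add, map_smul, smul_eq_mul]
      have := mul_lt_mul_of_pos_left hx ha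
      linarith
    · right
      simp only [map_add, map_smul, smul_eq_mul]
      have := mul_lt_mul_of_pos_left hx ha
      have := mul_lt_mul_of_pos_left hy hb
      linarith
  have hsub : convexHull ℝ (Set.range p) ⊆ {y | y = p i ∨ l y < l (p i)} := by
    refine convexHull_min ?_ hconv
    rintro _ ⟨k, rfl⟩
    by_cases h : k = i
    · exact Or.inl (by rw [h])
    · exact Or.inr (hl k h)
  refine ⟨subset_convexHull ℝ _ ⟨i, rfl⟩, l, fun y hy => ?_⟩
  rcases hsub hy with rfl | h
  · exact ⟨le_rfl, fun _ => rfl⟩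
  · exact ⟨h.le, fun h' => absurd h (not_lt.2 h')⟩

/-- A point at which a nonconstant linear functional attains its minimum over a set lies on the
frontier of the set. -/
theorem mem_frontier_of_forall_le {E : Type*} [AddCommGroup E] [Module ℝ E]
    [TopologicalSpace E] [ContinuousAdd E] [ContinuousSMul ℝ E] {s : Set E} {y v : E}
    (l : StrongDual ℝ E)
    (hy : y ∈ s) (hl : ∀ x ∈ s, l y ≤ l x) (hv : l v < 0) : y ∈ frontier s := by
  refine ⟨subset_closure hy, fun hint => ?_⟩
  have hc : Filter.Tendsto (fun t : ℝ => y + t • v) (nhds 0) (nhds y) := by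
    have : Continuous fun t : ℝ => y + t • v := by fun_prop
    simpa using this.tendsto 0
  have h1 : ∀ᶠ t : ℝ in nhdsWithin 0 (Set.Ioi 0), y + t • v ∈ s :=
    (hc.eventually (mem_interior_iff_mem_nhds.1 hint)).filter_mono nhdsWithin_le_nhds
  obtain ⟨t, ht, ht0⟩ := (h1.and self_mem_nhdsWithin).exists
  have h2 := hl _ ht
  rw [map_add, map_smul, smul_eq_mul] at h2
  have : t * l v < 0 := mul_neg_of_pos_of_neg ht0 hv
  linarith

/-- Points all of whose increasing triples are positively oriented are the vertices of a strictly
convex polygon, in this cyclic order. -/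
theorem isStrictlyConvexPolygon_of_orient_pos {M : ℕ} (hM : 2 ≤ M)
    {p : Fin (M + 1) → EuclideanSpace ℝ (Fin 2)}
    (hp : ∀ i j k : Fin (M + 1), i < j → j < k → 0 < orient (p i) (p j) (p k)) :
    IsStrictlyConvexPolygon p := by
  have hvert : ∀ i, ∃ l : StrongDual ℝ (EuclideanSpace ℝ (Fin 2)),
      ∀ k, k ≠ i → l (p k) < l (p i) := by
    intro i
    obtain ⟨a, b, hab, ha, hb, -⟩ := exists_cycleGraph_neighbours hM i
    obtain ⟨s, hs⟩ := exists_sign_of_orient_pos hM hp ha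
    obtain ⟨t, ht⟩ := exists_sign_of_orient_pos hM hp hb
    -- The sum of the inward normals of the two edges at the vertex supports the polygon there.
    refine ⟨-(s • orientCLM (p i) (p a) + t • orientCLM (p i) (p b)), fun k hk => ?_⟩
    have e1 := orientCLM_sub (p i) (p a) (p k) (p i)
    have e2 := orientCLM_sub (p i) (p b) (p k) (p i)
    rw [orient_self_left] at e1 e2
    have hsum : 0 < s * orient (p i) (p a) (p k) + t * orient (p i) (p b) (p k) := by
      by_cases hka : k = a
      · subst hka
        rw [orient_self_right, mul_zero, zero_add]
        exact ht k hk hab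
      · by_cases hkb : k = b
        · subst hkb
          rw [orient_self_right, mul_zero, add_zero]
          exact hs k hk hka
        · exact add_pos (hs k hk hka) (ht k hk hkb)
    have e3 : s * (orientCLM (p i) (p a) (p k) - orientCLM (p i) (p a) (p i)) =
      s * orient (p i) (p a) (p k) := by rw [e1, sub_zero]
    have e4 : t * (orientCLM (p i) (p b) (p k) - orientCLM (p i) (p b) (p i)) =
      t * orient (p i) (p b) (p k) := by rw [e2, sub_zero]
    simp only [neg_apply, add_apply, smul_apply, smul_eq_mul]
    linarith
  refine ⟨fun i j hij => ?_, fun i => ?_, fun i j hij => ?_⟩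
  · by_contra hne
    obtain ⟨l, hl⟩ := hvert i
    have := hl j (Ne.symm hne)
    rw [hij] at this
    exact lt_irrefl _ this
  · obtain ⟨l, hl⟩ := hvert i
    exact mem_exposedPoints_convexHull_range l hl
  · obtain ⟨s, hs⟩ := exists_sign_of_orient_pos hM hp hij
    obtain ⟨k, hki, hkj⟩ : ∃ k : Fin (M + 1), k ≠ i ∧ k ≠ j := by
      obtain ⟨a, b, hab, ha, hb, -⟩ := exists_cycleGraph_neighbours hM i
      by_cases h : a = j
      · exact ⟨b, hb.ne', fun h' => hab (h.trans h'.symm)⟩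
      · exact ⟨a, ha.ne', h⟩
    set l : StrongDual ℝ (EuclideanSpace ℝ (Fin 2)) := s • orientCLM (p i) (p j) with hldef
    have hle : ∀ x, l x - l (p i) = s * orient (p i) (p j) x := by
      intro x
      have e1 := orientCLM_sub (p i) (p j) x (p i)
      rw [orient_self_left, sub_zero] at e1
      simp only [hldef, smul_apply, smul_eq_mul]
      rw [← mul_sub, e1]
    have hj : l (p j) = l (p i) := by
      have := hle (p j)
      rw [orient_self_right] at this
      linarith
    have hhull : ∀ x ∈ convexHull ℝ (Set.range p), l (p i) ≤ l x := by
      have : convexHull ℝ (Set.range p) ⊆ {x | l (p i) ≤ l x} := by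
        refine convexHull_min ?_ (convex_halfSpace_ge l.toLinearMap.isLinear _)
        rintro _ ⟨k, rfl⟩
        show l (p i) ≤ l (p k)
        by_cases h1 : k = i
        · rw [h1]
        by_cases h2 : k = j
        · rw [h2]; exact hj.ge
        have := hle (p k)
        have := hs k h1 h2
        linarith
      exact this
    intro y hy
    have hyl : l y = l (p i) := by
      obtain ⟨a, b, -, -, hab, rfl⟩ := hy
      rw [map_add, map_smul, map_smul, hj, ← add_smul, hab, one_smul]
    refine mem_frontier_of_forall_le (v := p i - p k) l ?_ (fun x hx => ?_) ?_
    · exact segment_subset_convexHull (Set.mem_range_self i) (Set.mem_range_self j) hy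
    · rw [hyl]; exact hhull x hx
    · have := hle (p k)
      have := hs k hki hkj
      rw [map_sub]
      linarith

/-! ### Chains of unit edges with increasing directions -/

/-- The sum of the first `i` values of `f`. -/
noncomputable def partialSum {M : ℕ} (f : Fin M → ℝ) (i : ℕ) : ℝ :=
  ∑ k : Fin M, if (k : ℕ) < i then f k else 0

section partialSum

variable {M : ℕ} (f : Fin M → ℝ)

theorem partialSum_zero : partialSum f 0 = 0 := by simp [partialSum]

theorem partialSum_of_le {i : ℕ} (h : M ≤ i) : partialSum f i = ∑ k, f k := by
  refine Finset.sum_congr rfl fun k _ => ?_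
  rw [if_pos (lt_of_lt_of_le k.isLt h)]

theorem partialSum_sub_eq_sum_filter {i j : ℕ} (h : i ≤ j) :
    partialSum f j - partialSum f i =
      ∑ k ∈ Finset.univ.filter (fun k : Fin M => i ≤ (k : ℕ) ∧ (k : ℕ) < j), f k := by
  rw [partialSum, partialSum, ← Finset.sum_sub_distrib, Finset.sum_filter]
  refine Finset.sum_congr rfl fun k _ => ?_
  by_cases h1 : (k : ℕ) < i
  · rw [if_pos h1, if_pos (by omega), if_neg (by omega), sub_self]
  · by_cases h2 : (k : ℕ) < j
    · rw [if_pos h2, if_neg h1, if_pos (by omega), sub_zero]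
    · rw [if_neg h2, if_neg h1, if_neg (by omega), sub_zero]

theorem partialSum_succ (k : Fin M) : partialSum f (k + 1) = partialSum f k + f k := by
  have h := partialSum_sub_eq_sum_filter f (Nat.le_succ (k : ℕ))
  have : Finset.univ.filter (fun j : Fin M => (k : ℕ) ≤ (j : ℕ) ∧ (j : ℕ) < (k : ℕ).succ) = {k} := by
    ext j
    simp only [Finset.mem_filter, Finset.mem_univ, true_and, Finset.mem_singleton, Fin.ext_iff]
    omega
  rw [this, Finset.sum_singleton] at h
  rw [← h]
  simp

theorem partialSum_single (k : Fin M) (c : ℝ) (i : ℕ) :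
    partialSum (Pi.single k c) i = if (k : ℕ) < i then c else 0 := by
  rw [partialSum, Finset.sum_eq_single k]
  · simp
  · intro j _ hj
    simp [Pi.single_eq_of_ne hj]
  · simp

end partialSum

/-- The abscissa of the vertex `i` of the chain that starts at the origin and has unit edges with
directions `θ`. -/
noncomputable def chainX {M : ℕ} (θ : Fin M → ℝ) (i : ℕ) : ℝ :=
  partialSum (fun k => Real.cos (θ k)) i

/-- The ordinate of the vertex `i` of the chain that starts at the origin and has unit edges with
directions `θ`. -/
noncomputable def chainY {M : ℕ} (θ : Fin M → ℝ) (i : ℕ) : ℝ :=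
  partialSum (fun k => Real.sin (θ k)) i

/-- The vertices of the chain that starts at the origin and has unit edges with directions `θ`. -/
noncomputable def chainPoint {M : ℕ} (θ : Fin M → ℝ) (i : Fin (M + 1)) :
    EuclideanSpace ℝ (Fin 2) :=
  !₂[chainX θ i, chainY θ i]

section chain

variable {M : ℕ} {θ : Fin M → ℝ}

theorem orient_chainPoint (i j k : Fin (M + 1)) :
    orient (chainPoint θ i) (chainPoint θ j) (chainPoint θ k) =
      (chainX θ j - chainX θ i) * (chainY θ k - chainY θ i) -
        (chainY θ j - chainY θ i) * (chainX θ k - chainX θ i) := by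
  simp [orient, chainPoint]

/-- A chain whose directions increase strictly and span less than a half turn is strictly
convex. -/
theorem orient_chainPoint_pos (hθ : StrictMono θ)
    (hπ : ∀ k, -(Real.pi / 2) < θ k ∧ θ k < Real.pi / 2) {i j k : Fin (M + 1)}
    (hij : i < j) (hjk : j < k) :
    0 < orient (chainPoint θ i) (chainPoint θ j) (chainPoint θ k) := by
  have hij' : (i : ℕ) < j := hij
  have hjk' : (j : ℕ) < k := hjk
  have hk := k.isLt
  have h1 : orient (chainPoint θ i) (chainPoint θ j) (chainPoint θ k) =
      (chainX θ j - chainX θ i) * (chainY θ k - chainY θ j) -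
        (chainY θ j - chainY θ i) * (chainX θ k - chainX θ j) := by
    rw [orient_chainPoint]; ring
  rw [h1]
  simp only [chainX, chainY]
  rw [partialSum_sub_eq_sum_filter _ hij'.le, partialSum_sub_eq_sum_filter _ hij'.le,
    partialSum_sub_eq_sum_filter _ hjk'.le, partialSum_sub_eq_sum_filter _ hjk'.le,
    Finset.sum_mul_sum, Finset.sum_mul_sum, ← Finset.sum_sub_distrib]
  simp only [← Finset.sum_sub_distrib]
  refine Finset.sum_pos (fun a ha => Finset.sum_pos (fun b hb => ?_) ?_) ?_
  · simp only [Finset.mem_filter, Finset.mem_univ, true_and] at ha hb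
    have hab : θ a < θ b := hθ (show (a : ℕ) < b by omega)
    have : 0 < Real.sin (θ b - θ a) :=
      Real.sin_pos_of_pos_of_lt_pi (by linarith) (by linarith [(hπ a).1, (hπ b).2])
    rw [Real.sin_sub] at this
    linarith
  · exact ⟨⟨j, by omega⟩, by simp; omega⟩
  · exact ⟨⟨i, by omega⟩, by simp; omega⟩

/-- The height of the vertex `v` of the chain over the line of the edge `w`, as a sum over the
edges between them. -/
theorem chain_height_eq (w : Fin M) (v : ℕ) :
    Real.cos (θ w) * (chainY θ v - chainY θ w) - Real.sin (θ w) * (chainX θ v - chainX θ w) =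
      ∑ k ∈ Finset.univ.filter (fun k : Fin M => (w : ℕ) ≤ k ∧ (k : ℕ) < v),
          Real.sin (θ k - θ w) +
        ∑ k ∈ Finset.univ.filter (fun k : Fin M => v ≤ (k : ℕ) ∧ (k : ℕ) < w),
          Real.sin (θ w - θ k) := by
  simp only [chainX, chainY, Real.sin_sub, Finset.sum_sub_distrib, ← Finset.mul_sum,
    ← Finset.sum_mul]
  rcases le_total (w : ℕ) v with h | h
  · have h0 : Finset.univ.filter (fun k : Fin M => v ≤ (k : ℕ) ∧ (k : ℕ) < w) = ∅ := by
      ext k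
      simp only [Finset.mem_filter, Finset.mem_univ, true_and, Finset.notMem_empty, iff_false]
      omega
    rw [h0, ← partialSum_sub_eq_sum_filter _ h, ← partialSum_sub_eq_sum_filter _ h]
    simp only [Finset.sum_empty]
    ring
  · have h0 : Finset.univ.filter (fun k : Fin M => (w : ℕ) ≤ k ∧ (k : ℕ) < v) = ∅ := by
      ext k
      simp only [Finset.mem_filter, Finset.mem_univ, true_and, Finset.notMem_empty, iff_false]
      omega
    rw [h0, ← partialSum_sub_eq_sum_filter _ h, ← partialSum_sub_eq_sum_filter _ h]
    simp only [Finset.sum_empty]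
    ring

/-- A chain with increasing directions lies above the line of each of its edges. -/
theorem chain_height_nonneg (hθ : Monotone θ)
    (hπ : ∀ k, -(Real.pi / 2) < θ k ∧ θ k < Real.pi / 2) (w : Fin M) (v : ℕ) :
    0 ≤ Real.cos (θ w) * (chainY θ v - chainY θ w) -
      Real.sin (θ w) * (chainX θ v - chainX θ w) := by
  rw [chain_height_eq]
  refine add_nonneg (Finset.sum_nonneg fun k hk => ?_) (Finset.sum_nonneg fun k hk => ?_) <;>
    simp only [Finset.mem_filter, Finset.mem_univ, true_and] at hk <;>
    refine Real.sin_nonneg_of_nonneg_of_le_pi (sub_nonneg.2 (hθ (Fin.le_def.2 (by omega))))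
      (by linarith [(hπ k).1, (hπ w).2, (hπ k).2, (hπ w).1])

/-- The vertex `v` is strictly above the line of the edge `w` as soon as one edge between them
has another direction. -/
theorem chain_height_pos (hθ : Monotone θ)
    (hπ : ∀ k, -(Real.pi / 2) < θ k ∧ θ k < Real.pi / 2) (w : Fin M) (v : ℕ)
    (h : ∃ k : Fin M, ((w : ℕ) ≤ k ∧ (k : ℕ) < v ∨ v ≤ (k : ℕ) ∧ (k : ℕ) < w) ∧ θ k ≠ θ w) :
    0 < Real.cos (θ w) * (chainY θ v - chainY θ w) -
      Real.sin (θ w) * (chainX θ v - chainX θ w) := by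
  rw [chain_height_eq]
  have hn1 : ∀ k ∈ Finset.univ.filter (fun k : Fin M => (w : ℕ) ≤ k ∧ (k : ℕ) < v),
      0 ≤ Real.sin (θ k - θ w) := fun k hk => by
    simp only [Finset.mem_filter, Finset.mem_univ, true_and] at hk
    exact Real.sin_nonneg_of_nonneg_of_le_pi (sub_nonneg.2 (hθ (Fin.le_def.2 (by omega))))
      (by linarith [(hπ k).2, (hπ w).1])
  have hn2 : ∀ k ∈ Finset.univ.filter (fun k : Fin M => v ≤ (k : ℕ) ∧ (k : ℕ) < w),
      0 ≤ Real.sin (θ w - θ k) := fun k hk => by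
    simp only [Finset.mem_filter, Finset.mem_univ, true_and] at hk
    exact Real.sin_nonneg_of_nonneg_of_le_pi (sub_nonneg.2 (hθ (Fin.le_def.2 (by omega))))
      (by linarith [(hπ k).1, (hπ w).2])
  obtain ⟨k, hk | hk, hne⟩ := h
  · refine add_pos_of_pos_of_nonneg (Finset.sum_pos' hn1 ⟨k, by simpa using hk, ?_⟩)
      (Finset.sum_nonneg hn2)
    have : θ w ≤ θ k := hθ (Fin.le_def.2 (by omega))
    exact Real.sin_pos_of_pos_of_lt_pi (sub_pos.2 (lt_of_le_of_ne this hne.symm))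
      (by linarith [(hπ k).2, (hπ w).1])
  · refine add_pos_of_nonneg_of_pos (Finset.sum_nonneg hn1)
      (Finset.sum_pos' hn2 ⟨k, by simpa using hk, ?_⟩)
    have : θ k ≤ θ w := hθ (Fin.le_def.2 (by omega))
    exact Real.sin_pos_of_pos_of_lt_pi (sub_pos.2 (lt_of_le_of_ne this hne))
      (by linarith [(hπ k).1, (hπ w).2])

end chain

/-! ### Straight runs of edges -/

/-- A decidable lower set of `Fin M` consists of the elements below its cardinality. -/
theorem mem_iff_lt_card_of_isLowerSet {M : ℕ} {S : Finset (Fin M)}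
    (hS : IsLowerSet (S : Set (Fin M))) (j : Fin M) : j ∈ S ↔ (j : ℕ) < S.card := by
  constructor
  · intro hj
    have hsub : Finset.Iic j ⊆ S := fun k hk => hS (Finset.mem_Iic.1 hk) hj
    have := Finset.card_le_card hsub
    rw [Fin.card_Iic] at this
    omega
  · intro hj
    by_contra hjS
    have hsub : S ⊆ Finset.Iio j := fun k hk => by
      rw [Finset.mem_Iio]
      by_contra hkj
      exact hjS (hS (not_lt.1 hkj) hk)
    have := Finset.card_le_card hsub
    rw [Fin.card_Iio] at this
    omega

/-- The first vertex of the run of edges with direction `t`. -/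
noncomputable def runStart {M : ℕ} (θ : Fin M → ℝ) (t : ℝ) : ℕ :=
  (Finset.univ.filter fun j => θ j < t).card

/-- The last vertex of the run of edges with direction `t`. -/
noncomputable def runEnd {M : ℕ} (θ : Fin M → ℝ) (t : ℝ) : ℕ :=
  (Finset.univ.filter fun j => θ j ≤ t).card

section run

variable {M : ℕ} {θ : Fin M → ℝ}

theorem lt_runStart_iff (hθ : Monotone θ) (t : ℝ) (j : Fin M) :
    (j : ℕ) < runStart θ t ↔ θ j < t := by
  rw [runStart, ← mem_iff_lt_card_of_isLowerSet]
  · simp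
  · intro a b hba ha
    simp only [Finset.coe_filter, Finset.mem_univ, true_and, Set.mem_ofPred_eq] at ha ⊢
    exact lt_of_le_of_lt (hθ hba) ha

theorem lt_runEnd_iff (hθ : Monotone θ) (t : ℝ) (j : Fin M) :
    (j : ℕ) < runEnd θ t ↔ θ j ≤ t := by
  rw [runEnd, ← mem_iff_lt_card_of_isLowerSet]
  · simp
  · intro a b hba ha
    simp only [Finset.coe_filter, Finset.mem_univ, true_and, Set.mem_ofPred_eq] at ha ⊢
    exact le_trans (hθ hba) ha

theorem runStart_le (hθ : Monotone θ) (k : Fin M) : runStart θ (θ k) ≤ k := by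
  by_contra h
  exact lt_irrefl _ ((lt_runStart_iff hθ (θ k) k).1 (not_le.1 h))

theorem lt_runEnd (hθ : Monotone θ) (k : Fin M) : (k : ℕ) < runEnd θ (θ k) :=
  (lt_runEnd_iff hθ (θ k) k).2 le_rfl

theorem runEnd_le (t : ℝ) : runEnd θ t ≤ M := by
  simpa [runEnd] using Finset.card_le_univ (Finset.univ.filter fun j => θ j ≤ t)

/-- The outward speed of the vertex `m` when each straight run is bent into a parabola. -/
noncomputable def bulge (θ : Fin M → ℝ) (m : Fin M) : ℝ :=
  ((m : ℝ) - runStart θ (θ m)) * (runEnd θ (θ m) - m)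

/-- The angular speed of the edge `k` when each straight run is bent into a parabola: on the run
from `a` to `b` it is the difference quotient of `(m - a) * (b - m)` with the sign reversed. -/
noncomputable def bend (θ : Fin M → ℝ) (k : Fin M) : ℝ :=
  2 * k + 1 - runStart θ (θ k) - runEnd θ (θ k)

theorem bulge_nonneg (hθ : Monotone θ) (m : Fin M) : 0 ≤ bulge θ m := by
  have h1 : (runStart θ (θ m) : ℝ) ≤ (m : ℕ) := Nat.cast_le.2 (runStart_le hθ m)
  have h2 : ((m : ℕ) : ℝ) ≤ runEnd θ (θ m) := Nat.cast_le.2 (lt_runEnd hθ m).le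
  exact mul_nonneg (sub_nonneg.2 h1) (sub_nonneg.2 h2)

/-- Bending the runs moves the interior vertices of a run perpendicularly to it, and fixes the
corners: here in coordinates, with an arbitrary function `u` of the direction. -/
theorem partialSum_bend (hθ : Monotone θ) (u : ℝ → ℝ) (m : ℕ) (hm : m ≤ M) :
    partialSum (fun k => bend θ k * u (θ k)) m =
      if h : m < M then -(bulge θ ⟨m, h⟩ * u (θ ⟨m, h⟩)) else 0 := by
  induction m with
  | zero =>
    rw [partialSum_zero]
    split_ifs with h
    · have : runStart θ (θ ⟨0, h⟩) = 0 := Nat.le_zero.1 (runStart_le hθ ⟨0, h⟩)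
      simp [bulge, this]
    · rfl
  | succ m ih =>
    have hm' : m < M := hm
    have h1 := partialSum_succ (fun k => bend θ k * u (θ k)) ⟨m, hm'⟩
    simp only at h1
    rw [h1, ih hm'.le, dif_pos hm']
    have hE := lt_runEnd hθ ⟨m, hm'⟩
    simp only at hE
    have hval : -(bulge θ ⟨m, hm'⟩ * u (θ ⟨m, hm'⟩)) + bend θ ⟨m, hm'⟩ * u (θ ⟨m, hm'⟩) =
        -(((m : ℝ) + 1 - runStart θ (θ ⟨m, hm'⟩)) * (runEnd θ (θ ⟨m, hm'⟩) - (m + 1)) *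
          u (θ ⟨m, hm'⟩)) := by
      simp only [bulge, bend]; ring
    rw [hval]
    split_ifs with h
    · have hle : θ ⟨m, hm'⟩ ≤ θ ⟨m + 1, h⟩ := hθ (Fin.le_def.2 (Nat.le_succ m))
      rcases eq_or_lt_of_le hle with heq | hlt
      · simp only [bulge, ← heq]
        push_cast
        ring
      · -- The vertex is a corner: both runs that meet there have bulge zero.
        have e1 : runEnd θ (θ ⟨m, hm'⟩) = m + 1 := by
          refine le_antisymm (not_lt.1 fun hc => ?_) hE
          exact absurd ((lt_runEnd_iff hθ _ ⟨m + 1, h⟩).1 hc) (not_le.2 hlt)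
        have e2 : runStart θ (θ ⟨m + 1, h⟩) = m + 1 :=
          le_antisymm (runStart_le hθ ⟨m + 1, h⟩) ((lt_runStart_iff hθ _ ⟨m, hm'⟩).2 hlt)
        simp only [bulge, e1, e2]
        push_cast
        ring
    · have e1 : runEnd θ (θ ⟨m, hm'⟩) = m + 1 := by
        have := runEnd_le (θ := θ) (θ ⟨m, hm'⟩)
        omega
      rw [e1]
      push_cast
      ring

end run

/-! ### Moving along a level set -/

/-- A tangent vector of a regular level set is the velocity of a curve in the level set. -/
theorem exists_curve_of_mem_ker {V W : Type*} [NormedAddCommGroup V] [NormedSpace ℝ V]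
    [CompleteSpace V] [NormedAddCommGroup W] [NormedSpace ℝ W] [FiniteDimensional ℝ W]
    {F : V → W} {F' : V →L[ℝ] W} {a : V} (hF : HasStrictFDerivAt F F' a)
    (hsurj : Function.Surjective F') {τ : V} (hτ : F' τ = 0) :
    ∃ c : ℝ → V, c 0 = a ∧ HasDerivAt c τ 0 ∧ ∀ᶠ s in nhds (0 : ℝ), F (c s) = F a := by
  have hr : F'.range = ⊤ := LinearMap.range_eq_top.2 hsurj
  let t : F'.ker := ⟨τ, hτ⟩
  have hline : HasDerivAt (fun s : ℝ => s • t) t 0 := by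
    simpa using (hasDerivAt_id (0 : ℝ)).smul_const t
  refine ⟨fun s => hF.implicitFunction F F' hr (F a) (s • t), ?_, ?_, ?_⟩
  · simp
  · have h1 := (hF.to_implicitFunction hr).hasFDerivAt
    have h2 : HasFDerivAt (hF.implicitFunction F F' hr (F a)) F'.ker.subtypeL
        ((0 : ℝ) • t) := by rwa [zero_smul]
    exact h2.comp_hasDerivAt (0 : ℝ) hline
  · have h1 := hF.map_implicitFunction_eq hr
    have h2 : Filter.Tendsto (fun s : ℝ => (F a, s • t)) (nhds 0) (nhds (F a, 0)) := by
      have : Filter.Tendsto (fun s : ℝ => s • t) (nhds 0) (nhds 0) := by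
        simpa using hline.continuousAt.tendsto
      exact tendsto_const_nhds.prodMk_nhds this
    exact h2.eventually h1

/-! ### The energy of a chain and its derivative -/

/-- The weighted sum of the squared distances between the vertices of a chain, over ordered
pairs. -/
noncomputable def chainEnergy {M : ℕ} (w : Fin (M + 1) → Fin (M + 1) → ℝ) (θ : Fin M → ℝ) : ℝ :=
  ∑ i, ∑ j, w i j * ((chainX θ i - chainX θ j) ^ 2 + (chainY θ i - chainY θ j) ^ 2)

/-- The linear form that sums the first `i` coordinates with coefficients `c`. -/
noncomputable def partialSumCLM {M : ℕ} (c : Fin M → ℝ) (i : ℕ) : (Fin M → ℝ) →L[ℝ] ℝ :=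
  ∑ k : Fin M, (if (k : ℕ) < i then c k else 0) • ContinuousLinearMap.proj k

section energy

variable {M : ℕ}

theorem partialSumCLM_apply (c : Fin M → ℝ) (i : ℕ) (τ : Fin M → ℝ) :
    partialSumCLM c i τ = partialSum (fun k => τ k * c k) i := by
  simp only [partialSumCLM, partialSum, sum_apply, smul_apply,
    ContinuousLinearMap.proj_apply, smul_eq_mul]
  refine Finset.sum_congr rfl fun k _ => ?_
  split_ifs
  · ring
  · ring

theorem hasStrictFDerivAt_chainX (θ : Fin M → ℝ) (i : ℕ) :
    HasStrictFDerivAt (fun θ => chainX θ i) (partialSumCLM (fun k => -Real.sin (θ k)) i) θ := by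
  unfold chainX partialSum partialSumCLM
  refine HasStrictFDerivAt.fun_sum fun k _ => ?_
  split_ifs
  · have h : HasStrictFDerivAt (fun θ : Fin M → ℝ => θ k)
        (ContinuousLinearMap.proj k : (Fin M → ℝ) →L[ℝ] ℝ) θ :=
      hasStrictFDerivAt_apply k θ
    exact HasStrictFDerivAt.cos h
  · simpa using hasStrictFDerivAt_const (0 : ℝ) θ

theorem hasStrictFDerivAt_chainY (θ : Fin M → ℝ) (i : ℕ) :
    HasStrictFDerivAt (fun θ => chainY θ i) (partialSumCLM (fun k => Real.cos (θ k)) i) θ := by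
  unfold chainY partialSum partialSumCLM
  refine HasStrictFDerivAt.fun_sum fun k _ => ?_
  split_ifs
  · have h : HasStrictFDerivAt (fun θ : Fin M → ℝ => θ k)
        (ContinuousLinearMap.proj k : (Fin M → ℝ) →L[ℝ] ℝ) θ :=
      hasStrictFDerivAt_apply k θ
    exact HasStrictFDerivAt.sin h
  · simpa using hasStrictFDerivAt_const (0 : ℝ) θ

theorem continuous_chainX (i : ℕ) : Continuous fun θ : Fin M → ℝ => chainX θ i :=
  continuous_iff_continuousAt.2 fun θ => (hasStrictFDerivAt_chainX θ i).continuousAt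

theorem continuous_chainY (i : ℕ) : Continuous fun θ : Fin M → ℝ => chainY θ i :=
  continuous_iff_continuousAt.2 fun θ => (hasStrictFDerivAt_chainY θ i).continuousAt

/-- The velocity of the abscissa of the vertex `i` when the directions turn with speeds `τ`. -/
noncomputable def velX (θ τ : Fin M → ℝ) (i : ℕ) : ℝ :=
  partialSum (fun k => τ k * -Real.sin (θ k)) i

/-- The velocity of the ordinate of the vertex `i` when the directions turn with speeds `τ`. -/
noncomputable def velY (θ τ : Fin M → ℝ) (i : ℕ) : ℝ :=
  partialSum (fun k => τ k * Real.cos (θ k)) i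

/-- The horizontal component of the force that the weights `w` exert on the vertex `i`. -/
noncomputable def forceX (w : Fin (M + 1) → Fin (M + 1) → ℝ) (θ : Fin M → ℝ)
    (i : Fin (M + 1)) : ℝ :=
  ∑ j, w i j * (chainX θ i - chainX θ j)

/-- The vertical component of the force that the weights `w` exert on the vertex `i`. -/
noncomputable def forceY (w : Fin (M + 1) → Fin (M + 1) → ℝ) (θ : Fin M → ℝ)
    (i : Fin (M + 1)) : ℝ :=
  ∑ j, w i j * (chainY θ i - chainY θ j)

/-- A symmetric double sum of products of differences, in terms of the forces. -/
theorem sum_mul_sub_mul_sub {ι : Type*} [Fintype ι] {w : ι → ι → ℝ} (hw : ∀ i j, w i j = w j i)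
    (x v : ι → ℝ) :
    ∑ i, ∑ j, w i j * ((x i - x j) * (v i - v j)) =
      2 * ∑ i, (∑ j, w i j * (x i - x j)) * v i := by
  have h1 : ∑ i, ∑ j, w i j * ((x i - x j) * (v i - v j)) =
      ∑ i, ∑ j, w i j * (x i - x j) * v i + ∑ i, ∑ j, w i j * (x j - x i) * v j := by
    simp only [← Finset.sum_add_distrib]
    refine Finset.sum_congr rfl fun i _ => Finset.sum_congr rfl fun j _ => ?_
    ring
  have h2 : ∑ i, ∑ j, w i j * (x j - x i) * v j = ∑ i, ∑ j, w i j * (x i - x j) * v i := by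
    rw [Finset.sum_comm]
    refine Finset.sum_congr rfl fun i _ => Finset.sum_congr rfl fun j _ => ?_
    rw [hw]
  rw [h1, h2, ← two_mul]
  simp only [Finset.sum_mul]

/-- The derivative of the energy is the power of the forces. -/
theorem exists_hasStrictFDerivAt_chainEnergy {w : Fin (M + 1) → Fin (M + 1) → ℝ}
    (hw : ∀ i j, w i j = w j i) (θ : Fin M → ℝ) :
    ∃ E' : (Fin M → ℝ) →L[ℝ] ℝ, HasStrictFDerivAt (chainEnergy w) E' θ ∧
      ∀ τ, E' τ = 4 * ∑ i : Fin (M + 1),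
        (forceX w θ i * velX θ τ i + forceY w θ i * velY θ τ i) := by
  refine ⟨_, HasStrictFDerivAt.fun_sum fun i _ => HasStrictFDerivAt.fun_sum fun j _ =>
    HasStrictFDerivAt.const_mul (HasStrictFDerivAt.fun_add
      (HasStrictFDerivAt.pow
        (HasStrictFDerivAt.fun_sub (hasStrictFDerivAt_chainX θ i) (hasStrictFDerivAt_chainX θ j)) 2)
      (HasStrictFDerivAt.pow
        (HasStrictFDerivAt.fun_sub (hasStrictFDerivAt_chainY θ i) (hasStrictFDerivAt_chainY θ j))
        2)) (w i j), fun τ => ?_⟩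
  have h1 := sum_mul_sub_mul_sub hw (fun i : Fin (M + 1) => chainX θ i)
    (fun i : Fin (M + 1) => velX θ τ i)
  have h2 := sum_mul_sub_mul_sub hw (fun i : Fin (M + 1) => chainY θ i)
    (fun i : Fin (M + 1) => velY θ τ i)
  have h3 : 4 * ∑ i : Fin (M + 1), (forceX w θ i * velX θ τ i + forceY w θ i * velY θ τ i) =
      2 * (2 * ∑ i : Fin (M + 1), forceX w θ i * velX θ τ i) +
        2 * (2 * ∑ i : Fin (M + 1), forceY w θ i * velY θ τ i) := by
    rw [Finset.sum_add_distrib]; ring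
  rw [h3]
  simp only [forceX, forceY]
  rw [← h1, ← h2, Finset.mul_sum, Finset.mul_sum, ← Finset.sum_add_distrib]
  simp only [sum_apply]
  refine Finset.sum_congr rfl fun i _ => ?_
  rw [Finset.mul_sum, Finset.mul_sum, ← Finset.sum_add_distrib]
  refine Finset.sum_congr rfl fun j _ => ?_
  simp only [smul_apply, add_apply, sub_apply, partialSumCLM_apply, smul_eq_mul, velX, velY]
  norm_num
  ring

end energy

/-! ### The space of convex chains with a fixed base -/

/-- The convex chains of `M` unit edges from the origin to the point `(M - 1/2, 0)`, given by
their directions. As the base is longer than `M - 1`, every edge has a positive horizontal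
component; as it is shorter than `M`, the chain is not straight. -/
def chainSpace (M : ℕ) : Set (Fin M → ℝ) :=
  {θ | Monotone θ ∧ (∀ k, θ k ∈ Set.Icc (-(Real.pi / 2)) (Real.pi / 2)) ∧
    chainX θ M = M - 1 / 2 ∧ chainY θ M = 0}

section chainSpace

variable {M : ℕ} {θ : Fin M → ℝ}

theorem isCompact_chainSpace (M : ℕ) : IsCompact (chainSpace M) := by
  have h1 : IsCompact (Set.pi Set.univ fun _ : Fin M => Set.Icc (-(Real.pi / 2)) (Real.pi / 2)) :=
    isCompact_univ_pi fun _ => isCompact_Icc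
  refine h1.of_isClosed_subset ?_ fun θ hθ k _ => hθ.2.1 k
  have hs : chainSpace M = {θ | Monotone θ} ∩
      (Set.pi Set.univ (fun _ : Fin M => Set.Icc (-(Real.pi / 2)) (Real.pi / 2)) ∩
        ({θ | chainX θ M = M - 1 / 2} ∩ {θ | chainY θ M = 0})) := by
    ext θ
    simp only [chainSpace, Set.mem_inter_iff, Set.mem_pi, Set.mem_univ, true_imp_iff,
      Set.mem_ofPred_eq]
  rw [hs]
  refine IsClosed.inter isClosed_monotone (h1.isClosed.inter (IsClosed.inter ?_ ?_))
  · exact isClosed_eq (continuous_chainX M) continuous_const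
  · exact isClosed_eq (continuous_chainY M) continuous_const

theorem nonempty_chainSpace (hM : 2 ≤ M) : (chainSpace M).Nonempty := by
  -- A trapezium: only the first and the last edge are oblique, with cosine `3/4`.
  set φ := Real.arccos (3 / 4) with hφ
  have hcos : Real.cos φ = 3 / 4 := Real.cos_arccos (by norm_num) (by norm_num)
  have hφ0 : 0 ≤ φ := Real.arccos_nonneg _
  have hφ1 : φ ≤ Real.pi / 2 := Real.arccos_le_pi_div_two.2 (by norm_num)
  let f : Fin M := ⟨0, by omega⟩
  let l : Fin M := ⟨M - 1, by omega⟩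
  have hfl : f ≠ l := by simp only [f, l, ne_eq, Fin.mk.injEq]; omega
  let θ : Fin M → ℝ := fun k => if k = f then -φ else if k = l then φ else 0
  have hsum : ∀ u : ℝ → ℝ, ∑ k, u (θ k) = u (-φ) + u φ + ((M : ℝ) - 2) * u 0 := by
    intro u
    have e : ∀ k, u (θ k) = u 0 + ((if k = f then u (-φ) - u 0 else 0) +
        (if k = l then u φ - u 0 else 0)) := by
      intro k
      simp only [θ]
      by_cases h1 : k = f
      · have h2 : k ≠ l := h1 ▸ hfl
        rw [if_pos h1, if_pos h1, if_neg h2]; ring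
      · rw [if_neg h1, if_neg h1]
        by_cases h2 : k = l
        · rw [if_pos h2, if_pos h2]; ring
        · rw [if_neg h2, if_neg h2]; ring
    simp only [e, Finset.sum_add_distrib, Finset.sum_ite_eq', Finset.mem_univ, if_true,
      Finset.sum_const, Finset.card_univ, Fintype.card_fin, nsmul_eq_mul]
    ring
  refine ⟨θ, fun a b hab => ?_, fun k => ?_, ?_, ?_⟩
  · have hab' : (a : ℕ) ≤ b := hab
    have ha := a.isLt
    have hb := b.isLt
    simp only [θ, f, l, Fin.ext_iff]
    split_ifs <;> first | linarith | omega
  · simp only [θ]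
    split_ifs <;> constructor <;> linarith [Real.pi_pos]
  · rw [chainX, partialSum_of_le _ le_rfl, hsum Real.cos, Real.cos_neg, hcos, Real.cos_zero]
    ring
  · rw [chainY, partialSum_of_le _ le_rfl, hsum Real.sin, Real.sin_neg, Real.sin_zero]
    ring

theorem mem_Ioo_of_mem_chainSpace (h : θ ∈ chainSpace M) (k : Fin M) :
    -(Real.pi / 2) < θ k ∧ θ k < Real.pi / 2 := by
  have hc : 0 < Real.cos (θ k) := by
    have h1 : ∑ j, Real.cos (θ j) = M - 1 / 2 := by
      rw [← h.2.2.1, chainX, partialSum_of_le _ le_rfl]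
    rw [← Finset.add_sum_erase _ _ (Finset.mem_univ k)] at h1
    have h2 : ∑ j ∈ Finset.univ.erase k, Real.cos (θ j) ≤ (Finset.univ.erase k).card • (1 : ℝ) :=
      Finset.sum_le_card_nsmul _ _ _ fun j _ => Real.cos_le_one _
    have hM : 0 < M := lt_of_le_of_lt (Nat.zero_le _) k.isLt
    rw [Finset.card_erase_of_mem (Finset.mem_univ k), Finset.card_univ, Fintype.card_fin,
      nsmul_eq_mul, mul_one, Nat.cast_sub hM] at h2
    push_cast at h2
    linarith
  obtain ⟨h1, h2⟩ := h.2.1 k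
  refine ⟨lt_of_le_of_ne h1 fun he => ?_, lt_of_le_of_ne h2 fun he => ?_⟩
  · rw [← he, Real.cos_neg, Real.cos_pi_div_two] at hc
    exact lt_irrefl _ hc
  · rw [he, Real.cos_pi_div_two] at hc
    exact lt_irrefl _ hc

theorem exists_ne_of_mem_chainSpace (h : θ ∈ chainSpace M) (hM : 0 < M) (t : ℝ) :
    ∃ k, θ k ≠ t := by
  by_contra! hall
  have h1 := h.2.2.1
  have h2 := h.2.2.2
  rw [chainX, partialSum_of_le _ le_rfl] at h1
  rw [chainY, partialSum_of_le _ le_rfl] at h2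
  simp only [hall, Finset.sum_const, Finset.card_univ, Fintype.card_fin, nsmul_eq_mul] at h1 h2
  have hM' : (1 : ℝ) ≤ M := by exact_mod_cast hM
  have hs : Real.sin t = 0 := by
    rcases mul_eq_zero.1 h2 with h | h
    · linarith
    · exact h
  have hsq := Real.sin_sq_add_cos_sq t
  rw [hs] at hsq
  have hf : (Real.cos t - 1) * (Real.cos t + 1) = 0 := by nlinarith
  rcases mul_eq_zero.1 hf with h | h
  · rw [show Real.cos t = 1 by linarith] at h1
    linarith
  · rw [show Real.cos t = -1 by linarith] at h1
    linarith

/-- The end point of the chain. -/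
noncomputable def chainEnd (θ : Fin M → ℝ) : ℝ × ℝ := (chainX θ M, chainY θ M)

/-- The derivative of the end point of the chain. -/
noncomputable def chainEndDeriv (θ : Fin M → ℝ) : (Fin M → ℝ) →L[ℝ] ℝ × ℝ :=
  (partialSumCLM (fun k => -Real.sin (θ k)) M).prod (partialSumCLM (fun k => Real.cos (θ k)) M)

theorem hasStrictFDerivAt_chainEnd (θ : Fin M → ℝ) :
    HasStrictFDerivAt chainEnd (chainEndDeriv θ) θ :=
  (hasStrictFDerivAt_chainX θ M).prodMk (hasStrictFDerivAt_chainY θ M)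

theorem chainEndDeriv_apply (θ τ : Fin M → ℝ) :
    chainEndDeriv θ τ = (velX θ τ M, velY θ τ M) := by
  simp [chainEndDeriv, partialSumCLM_apply, velX, velY]

theorem velX_single (θ : Fin M → ℝ) (k : Fin M) (c : ℝ) (i : ℕ) :
    velX θ (Pi.single k c) i = if (k : ℕ) < i then -(c * Real.sin (θ k)) else 0 := by
  rw [velX, ← partialSum_single]
  congr 1
  funext j
  by_cases h : j = k
  · subst h; simp
  · simp [Pi.single_eq_of_ne h]

theorem velY_single (θ : Fin M → ℝ) (k : Fin M) (c : ℝ) (i : ℕ) :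
    velY θ (Pi.single k c) i = if (k : ℕ) < i then c * Real.cos (θ k) else 0 := by
  rw [velY, ← partialSum_single]
  congr 1
  funext j
  by_cases h : j = k
  · subst h; simp
  · simp [Pi.single_eq_of_ne h]

/-- The end point map is regular on the space of chains, as no chain in it is straight. -/
theorem surjective_chainEndDeriv (h : θ ∈ chainSpace M) (hM : 0 < M) :
    Function.Surjective (chainEndDeriv θ) := by
  obtain ⟨a, ha⟩ := exists_ne_of_mem_chainSpace h hM (θ ⟨0, hM⟩)
  set b : Fin M := ⟨0, hM⟩
  have hlt : θ b < θ a := lt_of_le_of_ne (h.1 (Fin.le_def.2 (Nat.zero_le _))) ha.symm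
  have hD : 0 < Real.sin (θ a - θ b) :=
    Real.sin_pos_of_pos_of_lt_pi (by linarith)
      (by linarith [(mem_Ioo_of_mem_chainSpace h a).2, (mem_Ioo_of_mem_chainSpace h b).1])
  rw [Real.sin_sub] at hD
  rintro ⟨x, y⟩
  set D := Real.sin (θ a) * Real.cos (θ b) - Real.cos (θ a) * Real.sin (θ b)
  -- Cramer's rule for the two directions.
  refine ⟨Pi.single a (-(x * Real.cos (θ b) + y * Real.sin (θ b)) / D) +
    Pi.single b ((x * Real.cos (θ a) + y * Real.sin (θ a)) / D), ?_⟩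
  rw [map_add, chainEndDeriv_apply, chainEndDeriv_apply]
  simp only [velX_single, velY_single, a.isLt, b.isLt, if_true, Prod.mk_add_mk]
  refine Prod.ext ?_ ?_
  · simp only
    rw [div_mul_eq_mul_div, div_mul_eq_mul_div, ← neg_div, ← neg_div, ← add_div,
      div_eq_iff hD.ne']
    ring
  · simp only
    rw [div_mul_eq_mul_div, div_mul_eq_mul_div, ← add_div, div_eq_iff hD.ne']
    ring

/-- A first-order necessary condition for a maximum over the space of chains: no motion that keeps
the end point and bends the chain strictly at all straight vertices increases the energy. -/
theorem deriv_nonpos_of_isMaxOn (hθ : θ ∈ chainSpace M) (hM : 0 < M) {f : (Fin M → ℝ) → ℝ}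
    {f' : (Fin M → ℝ) →L[ℝ] ℝ} (hf : HasStrictFDerivAt f f' θ)
    (hmax : IsMaxOn f (chainSpace M) θ) {τ : Fin M → ℝ} (hτ : chainEndDeriv θ τ = 0)
    (hbend : ∀ j k, j < k → θ j = θ k → τ j < τ k) : f' τ ≤ 0 := by
  by_contra! hpos
  obtain ⟨c, hc0, hcd, hcF⟩ := exists_curve_of_mem_ker (hasStrictFDerivAt_chainEnd θ)
    (surjective_chainEndDeriv hθ hM) hτ
  have hslope : ∀ {g : ℝ → ℝ} {d : ℝ}, HasDerivAt g d 0 → 0 < d →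
      ∀ᶠ s in nhdsWithin (0 : ℝ) (Set.Ioi 0), g 0 < g s := by
    intro g d hg hd
    have h1 := (hasDerivAt_iff_tendsto_slope.1 hg).eventually (lt_mem_nhds hd)
    have h2 : ∀ᶠ s in nhdsWithin (0 : ℝ) (Set.Ioi 0), 0 < slope g 0 s :=
      h1.filter_mono (nhdsWithin_mono _ fun x hx => ne_of_gt hx)
    filter_upwards [h2, self_mem_nhdsWithin] with s hs hs0
    rw [slope_def_field, sub_zero] at hs
    have hs0' : (0 : ℝ) < s := hs0
    have := (div_pos_iff_of_pos_right hs0').1 hs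
    linarith
  have hck : ∀ k, HasDerivAt (fun s => c s k) (τ k) 0 := hasDerivAt_pi.1 hcd
  have hE : ∀ᶠ s in nhdsWithin (0 : ℝ) (Set.Ioi 0), f (c 0) < f (c s) := by
    have h1 : HasFDerivAt f f' (c 0) := hc0.symm ▸ hf.hasFDerivAt
    exact hslope (h1.comp_hasDerivAt (0 : ℝ) hcd) hpos
  have hmono : ∀ᶠ s in nhdsWithin (0 : ℝ) (Set.Ioi 0), ∀ j k, j < k → c s j ≤ c s k := by
    refine Filter.eventually_all.2 fun j => Filter.eventually_all.2 fun k => ?_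
    by_cases hjk : j < k
    · rcases eq_or_lt_of_le (hθ.1 hjk.le) with he | hlt
      · have := hslope ((hck k).fun_sub (hck j)) (sub_pos.2 (hbend j k hjk he))
        filter_upwards [this] with s hs _
        rw [hc0, he, sub_self] at hs
        linarith
      · have h1 : ContinuousAt (fun s => c s k - c s j) 0 :=
          ((hck k).fun_sub (hck j)).continuousAt
        have h2 : ∀ᶠ s in nhds (0 : ℝ), 0 < c s k - c s j :=
          h1.eventually (lt_mem_nhds (by simp only [hc0]; linarith))
        filter_upwards [h2.filter_mono nhdsWithin_le_nhds] with s hs _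
        linarith
    · exact Filter.Eventually.of_forall fun s h => absurd h hjk
  have hbox : ∀ᶠ s in nhdsWithin (0 : ℝ) (Set.Ioi 0), ∀ k,
      c s k ∈ Set.Icc (-(Real.pi / 2)) (Real.pi / 2) := by
    refine Filter.eventually_all.2 fun k => ?_
    have h2 : ∀ᶠ s in nhds (0 : ℝ), c s k ∈ Set.Ioo (-(Real.pi / 2)) (Real.pi / 2) :=
      (hck k).continuousAt.eventually (Ioo_mem_nhds (by simp only [hc0]; exact
        (mem_Ioo_of_mem_chainSpace hθ k).1) (by simp only [hc0]; exact
        (mem_Ioo_of_mem_chainSpace hθ k).2))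
    filter_upwards [h2.filter_mono nhdsWithin_le_nhds] with s hs
    exact Set.Ioo_subset_Icc_self hs
  obtain ⟨s, h1, h2, h3, h4⟩ :=
    (hE.and (hmono.and (hbox.and (hcF.filter_mono nhdsWithin_le_nhds)))).exists
  have hmem : c s ∈ chainSpace M := by
    simp only [chainEnd, Prod.mk.injEq] at h4
    refine ⟨fun j k hjk => ?_, h3, h4.1.trans hθ.2.2.1, h4.2.trans hθ.2.2.2⟩
    rcases eq_or_lt_of_le hjk with rfl | hlt
    · exact le_rfl
    · exact h2 j k hlt
  have := hmax hmem
  rw [hc0] at h1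
  exact absurd this (not_le.2 h1)

end chainSpace

/-! ### Maximisers of the energy are strictly convex -/

section maximiser

variable {M : ℕ} {θ : Fin M → ℝ} {w : Fin (M + 1) → Fin (M + 1) → ℝ}

theorem chainEndDeriv_bend (hθ : Monotone θ) : chainEndDeriv θ (bend θ) = 0 := by
  have h1 := partialSum_bend hθ (fun t => -Real.sin t) M le_rfl
  have h2 := partialSum_bend hθ Real.cos M le_rfl
  rw [dif_neg (lt_irrefl M)] at h1 h2
  rw [chainEndDeriv_apply]
  exact Prod.ext h1 h2

/-- The power of the forces under the bending of all straight runs is a sum of weights times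
heights of vertices over edges. -/
theorem force_mul_vel_bend (hθ : Monotone θ) (i : Fin (M + 1)) :
    forceX w θ i * velX θ (bend θ) i + forceY w θ i * velY θ (bend θ) i =
      if h : (i : ℕ) < M then bulge θ ⟨i, h⟩ * ∑ j, w i j *
        (Real.cos (θ ⟨i, h⟩) * (chainY θ j - chainY θ i) -
          Real.sin (θ ⟨i, h⟩) * (chainX θ j - chainX θ i)) else 0 := by
  have h1 := partialSum_bend hθ (fun t => -Real.sin t) i (Nat.lt_succ_iff.1 i.isLt)
  have h2 := partialSum_bend hθ Real.cos i (Nat.lt_succ_iff.1 i.isLt)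
  rw [velX, velY, h1, h2]
  split_ifs with h
  · rw [forceX, forceY, Finset.sum_mul, Finset.sum_mul, Finset.mul_sum, ← Finset.sum_add_distrib]
    refine Finset.sum_congr rfl fun j _ => ?_
    ring
  · ring

/-- If the weights are nonnegative and every chord that is not an edge of the polygon is crossed by
a pair with positive weight, then an energy-maximising chain has no straight vertex: bending all
straight runs outwards at once preserves the end point to first order, and increases the distance
from the interior vertices of a run to all vertices off its line. -/
theorem strictMono_of_isMaxOn_chainEnergy (hM : 0 < M) (hθ : θ ∈ chainSpace M)
    (hw : ∀ i j, w i j = w j i) (hw0 : ∀ i j, 0 ≤ w i j)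
    (hcross : ∀ a u b : Fin (M + 1), a < u → u < b → ((a : ℕ) ≠ 0 ∨ (b : ℕ) ≠ M) →
      ∃ i j, a < i ∧ i < b ∧ (j < a ∨ b < j) ∧ 0 < w i j)
    (hmax : IsMaxOn (chainEnergy w) (chainSpace M) θ) : StrictMono θ := by
  have hmono := hθ.1
  have hπ := mem_Ioo_of_mem_chainSpace hθ
  refine hmono.strictMono_of_injective fun x y hxy => ?_
  by_contra hne
  obtain ⟨l, k, hlk, hθlk⟩ : ∃ l k : Fin M, l < k ∧ θ l = θ k := by
    rcases lt_or_gt_of_ne hne with h | h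
    · exact ⟨x, y, h, hxy⟩
    · exact ⟨y, x, h, hxy.symm⟩
  obtain ⟨E', hE, hE'⟩ := exists_hasStrictFDerivAt_chainEnergy hw θ
  have hle := deriv_nonpos_of_isMaxOn hθ hM hE hmax (chainEndDeriv_bend hmono) (by
    intro i j hij he
    have hij' : (i : ℝ) < (j : ℝ) := Nat.cast_lt.2 hij
    simp only [bend, he]
    linarith)
  have hnn : ∀ (i j : Fin (M + 1)) (h : (i : ℕ) < M),
      0 ≤ w i j * (Real.cos (θ ⟨i, h⟩) * (chainY θ j - chainY θ i) -
          Real.sin (θ ⟨i, h⟩) * (chainX θ j - chainX θ i)) :=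
    fun i j h => mul_nonneg (hw0 i j) (chain_height_nonneg hmono hπ ⟨i, h⟩ j)
  have haM : runStart θ (θ k) ≤ k := runStart_le hmono k
  have hbM : runEnd θ (θ k) ≤ M := runEnd_le _
  have hkb : (k : ℕ) < runEnd θ (θ k) := lt_runEnd hmono k
  have hak : runStart θ (θ k) < k := by
    refine lt_of_le_of_lt ?_ hlk
    rw [← hθlk]
    exact runStart_le hmono l
  have hkM := k.isLt
  obtain ⟨i, j, hai, hib, hj, hwij⟩ := hcross ⟨runStart θ (θ k), by omega⟩ ⟨k, by omega⟩
    ⟨runEnd θ (θ k), by omega⟩ hak hkb (by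
      by_contra! hall
      obtain ⟨m, hm⟩ := exists_ne_of_mem_chainSpace hθ hM (θ k)
      have h1 := (lt_runStart_iff hmono (θ k) m).not.1
      have h2 := (lt_runEnd_iff hmono (θ k) m).1
      simp only at hall
      rw [hall.1] at h1
      rw [hall.2] at h2
      exact hm (le_antisymm (h2 m.isLt) (not_lt.1 (h1 (Nat.not_lt_zero _)))))
  have hai' : runStart θ (θ k) < (i : ℕ) := hai
  have hib' : (i : ℕ) < runEnd θ (θ k) := hib
  have hiM : (i : ℕ) < M := by omega
  have hθi : θ ⟨i, hiM⟩ = θ k := by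
    refine le_antisymm ((lt_runEnd_iff hmono (θ k) ⟨i, hiM⟩).1 hib') (not_lt.1 ?_)
    rw [← lt_runStart_iff hmono]
    exact not_lt.2 hai'.le
  have hpos : 0 < E' (bend θ) := by
    rw [hE']
    refine mul_pos (by norm_num) (Finset.sum_pos' (fun i' _ => ?_) ⟨i, Finset.mem_univ i, ?_⟩)
    · rw [force_mul_vel_bend hmono]
      split_ifs with h
      · exact mul_nonneg (bulge_nonneg hmono _) (Finset.sum_nonneg fun j' _ => hnn i' j' h)
      · exact le_rfl
    · rw [force_mul_vel_bend hmono, dif_pos hiM]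
      refine mul_pos ?_ (Finset.sum_pos' (fun j' _ => hnn i j' hiM) ⟨j, Finset.mem_univ j, ?_⟩)
      · simp only [bulge, hθi]
        exact mul_pos (sub_pos.2 (Nat.cast_lt.2 hai')) (sub_pos.2 (Nat.cast_lt.2 hib'))
      · refine mul_pos hwij (chain_height_pos hmono hπ ⟨i, hiM⟩ j ?_)
        have hjM := j.isLt
        rcases hj with hj | hj
        · have hj' : (j : ℕ) < runStart θ (θ k) := hj
          refine ⟨⟨j, by omega⟩, Or.inr ⟨le_rfl, by simp only; omega⟩, ?_⟩
          rw [hθi]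
          exact ((lt_runStart_iff hmono (θ k) ⟨j, by omega⟩).1 hj').ne
        · have hj' : runEnd θ (θ k) < (j : ℕ) := hj
          refine ⟨⟨runEnd θ (θ k), by omega⟩, Or.inl ⟨by simp only; omega, hj'⟩, ?_⟩
          rw [hθi]
          have := (lt_runEnd_iff hmono (θ k) ⟨runEnd θ (θ k), by omega⟩).not.1 (lt_irrefl _)
          exact (not_le.1 this).ne'
  exact absurd hle (not_le.2 hpos)

/-- At a strictly convex maximiser the derivative of the energy is a combination of the derivatives
of the coordinates of the end point. -/
theorem exists_multipliers_of_isMaxOn (hM : 0 < M) (hθ : θ ∈ chainSpace M) (hs : StrictMono θ)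
    {f : (Fin M → ℝ) → ℝ} {f' : (Fin M → ℝ) →L[ℝ] ℝ} (hf : HasStrictFDerivAt f f' θ)
    (hmax : IsMaxOn f (chainSpace M) θ) :
    ∃ a b : ℝ, ∀ τ, f' τ = a * velX θ τ M + b * velY θ τ M := by
  have hker : ∀ τ, chainEndDeriv θ τ = 0 → f' τ = 0 := by
    intro τ hτ
    have hne : ∀ {σ : Fin M → ℝ} (j k : Fin M), j < k → θ j = θ k → σ j < σ k :=
      fun j k hjk he => absurd he (hs hjk).ne
    have h1 := deriv_nonpos_of_isMaxOn hθ hM hf hmax hτ hne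
    have h2 := deriv_nonpos_of_isMaxOn hθ hM hf hmax (τ := -τ) (by rw [map_neg, hτ, neg_zero]) hne
    rw [map_neg] at h2
    linarith
  obtain ⟨σ, hσ⟩ := surjective_chainEndDeriv hθ hM (1, 0)
  obtain ⟨ρ, hρ⟩ := surjective_chainEndDeriv hθ hM (0, 1)
  refine ⟨f' σ, f' ρ, fun τ => ?_⟩
  have h := hker (τ - velX θ τ M • σ - velY θ τ M • ρ) (by
    rw [map_sub, map_sub, map_smul, map_smul, hσ, hρ, chainEndDeriv_apply]
    simp)
  rw [map_sub, map_sub, map_smul, map_smul, smul_eq_mul, smul_eq_mul] at h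
  linarith

end maximiser

/-! ### The equilibrium stress of a maximiser -/

/-- The symmetric function that has the value `c k` on the edge from `k` to `k + 1` and the value
`d` on the edge from `0` to `M`. -/
noncomputable def cycleStress {M : ℕ} (c : ℕ → ℝ) (d : ℝ) (i j : Fin (M + 1)) : ℝ :=
  if (j : ℕ) = i + 1 then c i else if (i : ℕ) = j + 1 then c j
  else if ((i : ℕ) = 0 ∧ (j : ℕ) = M) ∨ ((i : ℕ) = M ∧ (j : ℕ) = 0) then d else 0

section stress

variable {M : ℕ}

theorem cycleStress_comm (c : ℕ → ℝ) (d : ℝ) (i j : Fin (M + 1)) :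
    cycleStress c d i j = cycleStress c d j i := by
  unfold cycleStress
  split_ifs <;> first | rfl | omega

theorem cycleStress_eq_zero (hM : 2 ≤ M) (c : ℕ → ℝ) (d : ℝ) {i j : Fin (M + 1)}
    (h : ¬ (SimpleGraph.cycleGraph (M + 1)).Adj i j) : cycleStress c d i j = 0 := by
  rw [cycleGraph_adj_iff_val hM] at h
  unfold cycleStress
  rw [if_neg (by tauto), if_neg (by tauto), if_neg (by tauto)]

/-- The sum of the values of `f` at the vertices after `k`. -/
noncomputable def tailSum (f : Fin (M + 1) → ℝ) (k : ℕ) : ℝ :=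
  ∑ i : Fin (M + 1), if k < (i : ℕ) then f i else 0

theorem tailSum_eq_add (f : Fin (M + 1) → ℝ) {k : ℕ} {i : Fin (M + 1)} (h : (i : ℕ) = k + 1) :
    tailSum f k = tailSum f i + f i := by
  have e : f i = ∑ j : Fin (M + 1), if j = i then f j else 0 := by simp
  rw [tailSum, tailSum, e, ← Finset.sum_add_distrib]
  refine Finset.sum_congr rfl fun j _ => ?_
  by_cases hj : j = i
  · subst hj
    rw [if_pos (by omega), if_neg (lt_irrefl _), if_pos rfl, zero_add]
  · have hj' : (j : ℕ) ≠ i := fun h => hj (Fin.ext h)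
    rw [if_neg hj, add_zero]
    by_cases h1 : k < (j : ℕ)
    · rw [if_pos h1, if_pos (by omega)]
    · rw [if_neg h1, if_neg (by omega)]

theorem tailSum_zero (f : Fin (M + 1) → ℝ) : tailSum f 0 + f 0 = ∑ i, f i := by
  rw [tailSum, Fin.sum_univ_succ, Fin.sum_univ_succ f]
  simp [add_comm]

theorem tailSum_last (f : Fin (M + 1) → ℝ) : tailSum f M = 0 :=
  Finset.sum_eq_zero fun i _ => if_neg (by omega)

/-- Forces with total zero whose partial sums are, up to the constant force of the base edge,
parallel to the edges of the chain are the forces of a stress on the closed polygon: here one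
coordinate `z` at a time. -/
theorem sum_cycleStress_mul_sub (hM : 2 ≤ M) (z : ℕ → ℝ) (f : Fin (M + 1) → ℝ)
    (hf : ∑ i, f i = 0) (c : ℕ → ℝ) (d : ℝ)
    (hc : ∀ k < M, tailSum f k = d * (z M - z 0) + c k * (z (k + 1) - z k))
    (i : Fin (M + 1)) : ∑ j : Fin (M + 1), cycleStress c d i j * (z i - z j) = f i := by
  have hi := i.isLt
  have hz : ∀ {a b : Fin (M + 1)}, a ≠ b → (∀ x, (SimpleGraph.cycleGraph (M + 1)).Adj i x →
      x = a ∨ x = b) → ∑ j : Fin (M + 1), cycleStress c d i j * (z i - z j) =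
        cycleStress c d i a * (z i - z a) + cycleStress c d i b * (z i - z b) := by
    intro a b hab h
    refine Fintype.sum_eq_add a b hab fun x hx => ?_
    rw [cycleStress_eq_zero hM c d (fun h' => ?_), zero_mul]
    rcases h x h' with h1 | h1
    · exact hx.1 h1
    · exact hx.2 h1
  have hadj := cycleGraph_adj_iff_val hM i
  rcases Nat.eq_zero_or_pos (i : ℕ) with h0 | h0
  · rw [hz (a := ⟨1, by omega⟩) (b := ⟨M, by omega⟩) (by simp only [ne_eq, Fin.mk.injEq]; omega)
      (fun x hx => by rw [hadj] at hx; simp only [Fin.ext_iff]; omega)]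
    have h1 := hc 0 (by omega)
    have h2 := tailSum_zero f
    have hi0 : i = 0 := Fin.ext h0
    subst hi0
    have e1 : cycleStress c d (0 : Fin (M + 1)) ⟨1, by omega⟩ = c 0 := by
      simp [cycleStress]
    have e2 : cycleStress c d (0 : Fin (M + 1)) ⟨M, by omega⟩ = d := by
      unfold cycleStress
      rw [if_neg (by simp only [Fin.val_zero]; omega), if_neg (by simp only [Fin.val_zero]; omega),
        if_pos (Or.inl ⟨rfl, rfl⟩)]
    rw [e1, e2]
    simp only [Fin.val_zero, zero_add] at h1 ⊢
    linarith
  · have hT := tailSum_eq_add f (show (i : ℕ) = (i - 1 : ℕ) + 1 by omega)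
    have h1 := hc (i - 1) (by omega)
    rw [show (i : ℕ) - 1 + 1 = i by omega] at h1
    rcases Nat.lt_or_ge (i : ℕ) M with h2 | h2
    · rw [hz (a := ⟨i + 1, by omega⟩) (b := ⟨i - 1, by omega⟩)
        (by simp only [ne_eq, Fin.mk.injEq]; omega)
        (fun x hx => by rw [hadj] at hx; simp only [Fin.ext_iff]; omega)]
      have h3 := hc i h2
      have e1 : cycleStress c d i ⟨i + 1, by omega⟩ = c i := by
        unfold cycleStress
        rw [if_pos rfl]
      have e2 : cycleStress c d i ⟨i - 1, by omega⟩ = c (i - 1) := by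
        unfold cycleStress
        rw [if_neg (by simp only; omega), if_pos (by simp only; omega)]
      rw [e1, e2]
      simp only
      linarith
    · have hiM : (i : ℕ) = M := by omega
      rw [hz (a := ⟨0, by omega⟩) (b := ⟨M - 1, by omega⟩)
        (by simp only [ne_eq, Fin.mk.injEq]; omega)
        (fun x hx => by rw [hadj] at hx; simp only [Fin.ext_iff]; omega)]
      have e1 : cycleStress c d i ⟨0, by omega⟩ = d := by
        unfold cycleStress
        rw [if_neg (by simp only; omega), if_neg (by simp only; omega),
          if_pos (Or.inr ⟨hiM, rfl⟩)]
      have e2 : cycleStress c d i ⟨M - 1, by omega⟩ = c (i - 1) := by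
        unfold cycleStress
        rw [if_neg (by simp only; omega), if_pos (by simp only; omega), hiM]
      rw [e1, e2]
      rw [hiM] at hT h1 ⊢
      rw [tailSum_last] at hT
      simp only
      linarith

/-- The forces of symmetric weights at a strictly convex maximiser are balanced by a stress on the
edges of the polygon. -/
theorem exists_cycleStress_of_isMaxOn (hM : 2 ≤ M) {θ : Fin M → ℝ} (hθ : θ ∈ chainSpace M)
    (hs : StrictMono θ) {w : Fin (M + 1) → Fin (M + 1) → ℝ} (hw : ∀ i j, w i j = w j i)
    (hmax : IsMaxOn (chainEnergy w) (chainSpace M) θ) :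
    ∃ (c : ℕ → ℝ) (d : ℝ), ∀ i : Fin (M + 1),
      ∑ j : Fin (M + 1), cycleStress c d i j * (chainX θ i - chainX θ j) = forceX w θ i ∧
      ∑ j : Fin (M + 1), cycleStress c d i j * (chainY θ i - chainY θ j) = forceY w θ i := by
  obtain ⟨E', hE, hE'⟩ := exists_hasStrictFDerivAt_chainEnergy hw θ
  obtain ⟨a, b, hab⟩ := exists_multipliers_of_isMaxOn (by omega) hθ hs hE hmax
  have hlag : ∀ τ, ∑ i : Fin (M + 1), (forceX w θ i * velX θ τ i + forceY w θ i * velY θ τ i) =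
      a / 4 * velX θ τ M + b / 4 * velY θ τ M := by
    intro τ
    have := hE' τ
    rw [hab τ] at this
    linarith
  have hL : (0 : ℝ) < M - 1 / 2 := by
    have : (2 : ℝ) ≤ M := by exact_mod_cast hM
    linarith
  have hsumX : ∑ i, forceX w θ i = 0 := by
    have := sum_mul_sub_mul_sub hw (fun i : Fin (M + 1) => chainX θ i) (fun _ => 1)
    simp only [sub_self, mul_zero, mul_one, Finset.sum_const_zero] at this
    simp only [forceX]
    linarith
  have hsumY : ∑ i, forceY w θ i = 0 := by
    have := sum_mul_sub_mul_sub hw (fun i : Fin (M + 1) => chainY θ i) (fun _ => 1)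
    simp only [sub_self, mul_zero, mul_one, Finset.sum_const_zero] at this
    simp only [forceY]
    linarith
  -- The total torque of the internal forces vanishes, so the force in the base is horizontal.
  have hb : b = 0 := by
    have h1 := hlag (fun _ => 1)
    have eX : ∀ i, velX θ (fun _ => 1) i = -chainY θ i := fun i => by
      simp only [velX, chainY, partialSum, one_mul, ← Finset.sum_neg_distrib]
      refine Finset.sum_congr rfl fun k _ => ?_
      split_ifs <;> simp
    have eY : ∀ i, velY θ (fun _ => 1) i = chainX θ i := fun i => by
      simp only [velY, chainX, one_mul]
    have h2 := sum_mul_sub_mul_sub hw (fun i : Fin (M + 1) => chainX θ i)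
      (fun i : Fin (M + 1) => -chainY θ i)
    have h3 := sum_mul_sub_mul_sub hw (fun i : Fin (M + 1) => chainY θ i)
      (fun i : Fin (M + 1) => chainX θ i)
    have h4 : ∑ i : Fin (M + 1), ∑ j : Fin (M + 1),
          w i j * ((chainX θ i - chainX θ j) * (-chainY θ i - -chainY θ j)) +
        ∑ i : Fin (M + 1), ∑ j : Fin (M + 1),
          w i j * ((chainY θ i - chainY θ j) * (chainX θ i - chainX θ j)) = 0 := by
      rw [← Finset.sum_add_distrib]
      refine Finset.sum_eq_zero fun i _ => ?_
      rw [← Finset.sum_add_distrib]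
      refine Finset.sum_eq_zero fun j _ => ?_
      ring
    simp only [eX, eY] at h1
    rw [Finset.sum_add_distrib] at h1
    simp only [forceX, forceY] at h1
    rw [hθ.2.2.1, hθ.2.2.2] at h1
    have h5 : b / 4 * ((M : ℝ) - 1 / 2) = 0 := by linarith
    rcases mul_eq_zero.1 h5 with h | h
    · linarith
    · linarith
  subst hb
  let c : ℕ → ℝ := fun k => if h : k < M then
    (tailSum (forceX w θ) k - a / 4) * Real.cos (θ ⟨k, h⟩) +
      tailSum (forceY w θ) k * Real.sin (θ ⟨k, h⟩) else 0
  have hpar : ∀ k : Fin M, tailSum (forceY w θ) k * Real.cos (θ k) =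
      (tailSum (forceX w θ) k - a / 4) * Real.sin (θ k) := by
    intro k
    have h1 := hlag (Pi.single k 1)
    simp only [velX_single, velY_single, k.isLt, if_true] at h1
    have h2 : ∑ i : Fin (M + 1),
        ((forceX w θ i * if (k : ℕ) < i then -(1 * Real.sin (θ k)) else 0) +
          forceY w θ i * if (k : ℕ) < i then 1 * Real.cos (θ k) else 0) =
        -(tailSum (forceX w θ) k * Real.sin (θ k)) + tailSum (forceY w θ) k * Real.cos (θ k) := by
      rw [tailSum, tailSum, Finset.sum_mul, Finset.sum_mul, ← Finset.sum_neg_distrib,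
        ← Finset.sum_add_distrib]
      refine Finset.sum_congr rfl fun i _ => ?_
      split_ifs <;> ring
    rw [h2] at h1
    linarith
  have h0X : chainX θ 0 = 0 := partialSum_zero _
  have h0Y : chainY θ 0 = 0 := partialSum_zero _
  refine ⟨c, a / 4 / (M - 1 / 2), fun i => ⟨?_, ?_⟩⟩
  · refine sum_cycleStress_mul_sub hM (fun m => chainX θ m) _ hsumX c _ (fun k hk => ?_) i
    have h1 : chainX θ (k + 1) - chainX θ k = Real.cos (θ ⟨k, hk⟩) := by
      have := partialSum_succ (fun k => Real.cos (θ k)) ⟨k, hk⟩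
      simp only [chainX] at this ⊢
      linarith
    have h2 := hpar ⟨k, hk⟩
    simp only [h1, h0X, hθ.2.2.1, sub_zero, c, dif_pos hk]
    simp only at h2
    rw [div_mul_cancel₀ _ hL.ne']
    have h3 := Real.sin_sq_add_cos_sq (θ ⟨k, hk⟩)
    linear_combination
      (tailSum (forceX w θ) k - a / 4) * (-h3) - Real.sin (θ ⟨k, hk⟩) * h2
  · refine sum_cycleStress_mul_sub hM (fun m => chainY θ m) _ hsumY c _ (fun k hk => ?_) i
    have h1 : chainY θ (k + 1) - chainY θ k = Real.sin (θ ⟨k, hk⟩) := by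
      have := partialSum_succ (fun k => Real.sin (θ k)) ⟨k, hk⟩
      simp only [chainY] at this ⊢
      linarith
    have h2 := hpar ⟨k, hk⟩
    simp only [h1, h0Y, hθ.2.2.2, sub_zero, mul_zero, zero_add, c, dif_pos hk]
    simp only at h2
    have h3 := Real.sin_sq_add_cos_sq (θ ⟨k, hk⟩)
    linear_combination
      tailSum (forceY w θ) k * (-h3) + Real.cos (θ ⟨k, hk⟩) * h2

end stress

/-! ### Signs of the stress, and perturbation of the weights -/

section signs

variable {M : ℕ}

/-- The cross product of the force of the weights on the vertex `i` with the vector from `i` to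
`a`. -/
noncomputable def moment (w : Fin (M + 1) → Fin (M + 1) → ℝ) (θ : Fin M → ℝ)
    (i a : Fin (M + 1)) : ℝ :=
  ∑ j, w i j * orient (chainPoint θ i) (chainPoint θ a) (chainPoint θ j)

theorem moment_eq_force (w : Fin (M + 1) → Fin (M + 1) → ℝ) (θ : Fin M → ℝ)
    (i a : Fin (M + 1)) :
    moment w θ i a = (chainY θ a - chainY θ i) * (∑ j, w i j * (chainX θ i - chainX θ j)) -
      (chainX θ a - chainX θ i) * ∑ j, w i j * (chainY θ i - chainY θ j) := by
  rw [moment, Finset.mul_sum, Finset.mul_sum, ← Finset.sum_sub_distrib]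
  refine Finset.sum_congr rfl fun j _ => ?_
  rw [orient_chainPoint]
  ring

/-- The condition on the weights that makes the stress on the polygon positive: at each vertex the
force of the weights points into the angle opposite to the angle of the polygon. -/
def HasOutwardForces (w : Fin (M + 1) → Fin (M + 1) → ℝ) (θ : Fin M → ℝ) : Prop :=
  ∀ i a b : Fin (M + 1), (SimpleGraph.cycleGraph (M + 1)).Adj i a →
    (SimpleGraph.cycleGraph (M + 1)).Adj i b → a ≠ b →
      0 < moment w θ i a * orient (chainPoint θ i) (chainPoint θ a) (chainPoint θ b)

/-- Nonnegative weights that do not vanish identically at any vertex exert outward forces on a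
strictly convex chain. -/
theorem hasOutwardForces_of_nonneg (hM : 2 ≤ M) {θ : Fin M → ℝ} (hs : StrictMono θ)
    (hπ : ∀ k, -(Real.pi / 2) < θ k ∧ θ k < Real.pi / 2)
    {w : Fin (M + 1) → Fin (M + 1) → ℝ} (hw0 : ∀ i j, 0 ≤ w i j)
    (hdeg : ∀ i, ∃ j, j ≠ i ∧ ¬ (SimpleGraph.cycleGraph (M + 1)).Adj i j ∧ 0 < w i j) :
    HasOutwardForces w θ := by
  intro i a b hia hib hab
  obtain ⟨s, hs'⟩ := exists_sign_of_orient_pos hM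
    (fun _ _ _ h1 h2 => orient_chainPoint_pos hs hπ h1 h2) hia
  have hprod : ∀ j, j ≠ i → j ≠ a →
      0 < orient (chainPoint θ i) (chainPoint θ a) (chainPoint θ j) *
        orient (chainPoint θ i) (chainPoint θ a) (chainPoint θ b) := by
    intro j hji hja
    have h1 := mul_pos (hs' j hji hja) (hs' b hib.ne' hab.symm)
    have h2 : 0 < s * s * (orient (chainPoint θ i) (chainPoint θ a) (chainPoint θ j) *
        orient (chainPoint θ i) (chainPoint θ a) (chainPoint θ b)) := by linarith
    exact pos_of_mul_pos_right h2 (mul_self_nonneg s)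
  rw [moment, Finset.sum_mul]
  obtain ⟨j, hji, hjadj, hj⟩ := hdeg i
  refine Finset.sum_pos' (fun k _ => ?_) ⟨j, Finset.mem_univ j, ?_⟩
  · rw [mul_assoc]
    refine mul_nonneg (hw0 i k) ?_
    by_cases h1 : k = i
    · rw [h1, orient_self_left, zero_mul]
    · by_cases h2 : k = a
      · rw [h2, orient_self_right, zero_mul]
      · exact (hprod k h1 h2).le
  · rw [mul_assoc]
    refine mul_pos hj (hprod j hji ?_)
    rintro rfl
    exact hjadj hia

/-- A stress on the polygon that balances outward forces is positive. -/
theorem cycleStress_pos (hM : 2 ≤ M) {θ : Fin M → ℝ} {w : Fin (M + 1) → Fin (M + 1) → ℝ}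
    (hout : HasOutwardForces w θ) {c : ℕ → ℝ} {d : ℝ}
    (hbal : ∀ i : Fin (M + 1),
      ∑ j : Fin (M + 1), cycleStress c d i j * (chainX θ i - chainX θ j) = forceX w θ i ∧
      ∑ j : Fin (M + 1), cycleStress c d i j * (chainY θ i - chainY θ j) = forceY w θ i)
    {i b : Fin (M + 1)} (hib : (SimpleGraph.cycleGraph (M + 1)).Adj i b) :
    0 < cycleStress c d i b := by
  obtain ⟨a, hia, hab, hnb⟩ : ∃ a, (SimpleGraph.cycleGraph (M + 1)).Adj i a ∧ a ≠ b ∧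
      ∀ x, (SimpleGraph.cycleGraph (M + 1)).Adj i x → x = a ∨ x = b := by
    obtain ⟨x, y, hxy, hx, hy, h⟩ := exists_cycleGraph_neighbours hM i
    rcases h b hib with rfl | rfl
    · exact ⟨y, hy, hxy.symm, fun z hz => (h z hz).symm⟩
    · exact ⟨x, hx, hxy, h⟩
  have h1 := hout i a b hia hib hab
  have h2 : moment w θ i a = moment (cycleStress c d) θ i a := by
    rw [moment_eq_force, moment_eq_force, (hbal i).1, (hbal i).2, forceX, forceY]
  have h3 : moment (cycleStress c d) θ i a =
      cycleStress c d i b * orient (chainPoint θ i) (chainPoint θ a) (chainPoint θ b) := by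
    rw [moment]
    refine Finset.sum_eq_single b (fun j _ hj => ?_) (fun h => absurd (Finset.mem_univ b) h)
    by_cases hadj : (SimpleGraph.cycleGraph (M + 1)).Adj i j
    · rw [(hnb j hadj).resolve_right hj, orient_self_right, mul_zero]
    · rw [cycleStress_eq_zero hM c d hadj, zero_mul]
  rw [h2, h3, mul_assoc] at h1
  exact pos_of_mul_pos_left h1 (mul_self_nonneg _)

theorem continuous_orient_chainPoint (i j k : Fin (M + 1)) : Continuous fun θ : Fin M → ℝ =>
    orient (chainPoint θ i) (chainPoint θ j) (chainPoint θ k) := by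
  simp only [orient_chainPoint]
  have hX := fun i : ℕ => continuous_chainX (M := M) i
  have hY := fun i : ℕ => continuous_chainY (M := M) i
  exact (((hX j).sub (hX i)).mul ((hY k).sub (hY i))).sub
    (((hY j).sub (hY i)).mul ((hX k).sub (hX i)))

/-- The weights `w₀`, perturbed by a small multiple of the weights `w₁` with the opposite sign. -/
def perturbedWeights (w₀ w₁ : Fin (M + 1) → Fin (M + 1) → ℝ) (η : ℝ) :
    Fin (M + 1) → Fin (M + 1) → ℝ :=
  fun i j => w₀ i j - η * w₁ i j

theorem continuous_chainEnergy_perturbedWeights (w₀ w₁ : Fin (M + 1) → Fin (M + 1) → ℝ) :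
    Continuous fun x : ℝ × (Fin M → ℝ) => chainEnergy (perturbedWeights w₀ w₁ x.1) x.2 := by
  have hX := fun i : ℕ => (continuous_chainX (M := M) i).comp (continuous_snd (X := ℝ))
  have hY := fun i : ℕ => (continuous_chainY (M := M) i).comp (continuous_snd (X := ℝ))
  simp only [Function.comp_def] at hX hY
  unfold chainEnergy perturbedWeights
  refine continuous_finsetSum _ fun i _ => continuous_finsetSum _ fun j _ => ?_
  exact (continuous_const.sub (continuous_fst.mul continuous_const)).mul
    ((((hX i).sub (hX j)).pow 2).add (((hY i).sub (hY j)).pow 2))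

theorem isOpen_strictMono_inter_hasOutwardForces (w₀ w₁ : Fin (M + 1) → Fin (M + 1) → ℝ) :
    IsOpen {x : ℝ × (Fin M → ℝ) |
      StrictMono x.2 ∧ HasOutwardForces (perturbedWeights w₀ w₁ x.1) x.2} := by
  simp only [StrictMono, HasOutwardForces]
  refine IsOpen.and ?_ ?_
  · simp only [Set.ofPred_forall]
    refine isOpen_iInter_of_finite fun a => isOpen_iInter_of_finite fun b =>
      isOpen_iInter_of_finite fun _ => ?_
    exact isOpen_lt ((continuous_apply a).comp continuous_snd)
      ((continuous_apply b).comp continuous_snd)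
  · simp only [Set.ofPred_forall]
    refine isOpen_iInter_of_finite fun i => isOpen_iInter_of_finite fun a =>
      isOpen_iInter_of_finite fun b => isOpen_iInter_of_finite fun _ =>
      isOpen_iInter_of_finite fun _ => isOpen_iInter_of_finite fun _ => ?_
    have ho := fun i j k : Fin (M + 1) =>
      (continuous_orient_chainPoint i j k).comp (continuous_snd (X := ℝ))
    simp only [Function.comp_def] at ho
    refine isOpen_lt continuous_const (Continuous.mul ?_ (ho i a b))
    unfold moment perturbedWeights
    refine continuous_finsetSum _ fun j _ => ?_
    exact (continuous_const.sub (continuous_fst.mul continuous_const)).mul (ho i a j)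

/-- A small perturbation of weights that satisfy the crossing condition still has a strictly convex
energy-maximising chain with outward forces: the maximisers of perturbed energies accumulate at a
maximiser of the unperturbed one, and both properties are open. -/
theorem exists_isMaxOn_perturbedWeights (hM : 2 ≤ M)
    {w₀ : Fin (M + 1) → Fin (M + 1) → ℝ} (w₁ : Fin (M + 1) → Fin (M + 1) → ℝ)
    (hw : ∀ i j, w₀ i j = w₀ j i) (hw0 : ∀ i j, 0 ≤ w₀ i j)
    (hcross : ∀ a u b : Fin (M + 1), a < u → u < b → ((a : ℕ) ≠ 0 ∨ (b : ℕ) ≠ M) →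
      ∃ i j, a < i ∧ i < b ∧ (j < a ∨ b < j) ∧ 0 < w₀ i j)
    (hdeg : ∀ i, ∃ j, j ≠ i ∧ ¬ (SimpleGraph.cycleGraph (M + 1)).Adj i j ∧ 0 < w₀ i j) :
    ∃ η : ℝ, 0 < η ∧ ∃ θ ∈ chainSpace M,
      IsMaxOn (chainEnergy (perturbedWeights w₀ w₁ η)) (chainSpace M) θ ∧
      StrictMono θ ∧ HasOutwardForces (perturbedWeights w₀ w₁ η) θ := by
  have hcont := continuous_chainEnergy_perturbedWeights w₀ w₁
  have hcontη : ∀ η, Continuous (chainEnergy (perturbedWeights w₀ w₁ η)) := fun η =>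
    hcont.comp (Continuous.prodMk_right η)
  let e : ℕ → ℝ := fun m => 1 / ((m : ℝ) + 1)
  choose t ht htmax using fun m : ℕ => (isCompact_chainSpace M).exists_isMaxOn
    (nonempty_chainSpace hM) (hcontη (e m)).continuousOn
  obtain ⟨θ, hθ, φ, hφ, hlim⟩ := (isCompact_chainSpace M).tendsto_subseq ht
  have he : Filter.Tendsto (fun m => e (φ m)) Filter.atTop (nhds 0) :=
    tendsto_one_div_add_atTop_nhds_zero_nat.comp hφ.tendsto_atTop
  have hpair : Filter.Tendsto (fun m => (e (φ m), t (φ m))) Filter.atTop (nhds (0, θ)) :=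
    he.prodMk_nhds hlim
  have h0 : perturbedWeights w₀ w₁ 0 = w₀ := by
    funext i j
    simp [perturbedWeights]
  have hmax : IsMaxOn (chainEnergy w₀) (chainSpace M) θ := by
    intro ψ hψ
    have h1 := (hcont.tendsto (0, θ)).comp hpair
    have h2 := (hcont.tendsto (0, ψ)).comp (he.prodMk_nhds (tendsto_const_nhds (x := ψ)))
    have h3 := le_of_tendsto_of_tendsto' h2 h1 fun m => htmax (φ m) hψ
    simp only [h0] at h3
    exact h3
  have hs := strictMono_of_isMaxOn_chainEnergy (by omega) hθ hw hw0 hcross hmax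
  have hout := hasOutwardForces_of_nonneg hM hs (mem_Ioo_of_mem_chainSpace hθ) hw0 hdeg
  have hev := hpair.eventually ((isOpen_strictMono_inter_hasOutwardForces w₀ w₁).mem_nhds
    (show StrictMono θ ∧ HasOutwardForces (perturbedWeights w₀ w₁ 0) θ from
      ⟨hs, by rwa [h0]⟩))
  obtain ⟨m, hm⟩ := hev.exists
  exact ⟨e (φ m), Nat.one_div_pos_of_nat, t (φ m), ht _, htmax _, hm.1, hm.2⟩

end signs

/-! ### Three-connected braced polygons -/

/-- In a `3`-connected graph, two vertices `a` and `b` cannot cut off a set `S` of vertices: some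
edge that avoids both of them leaves `S`. -/
theorem IsKConnected.exists_adj_of_two {V : Type*} [Fintype V] {G : SimpleGraph V}
    (hG : IsKConnected 3 G) (a b : V) (S : Set V) {u v : V} (hu : u ∈ S) (hv : v ∉ S)
    (hua : u ≠ a) (hub : u ≠ b) (hva : v ≠ a) (hvb : v ≠ b) :
    ∃ i j, i ∈ S ∧ j ∉ S ∧ i ≠ a ∧ i ≠ b ∧ j ≠ a ∧ j ≠ b ∧ G.Adj i j := by
  classical
  have hcard : ({a, b} : Finset V).card < 3 := lt_of_le_of_lt Finset.card_le_two (by norm_num)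
  have hconn := hG.2 {a, b} hcard
  have hu' : u ∈ {v : V | v ∉ ({a, b} : Finset V)} := by simp [hua, hub]
  have hv' : v ∈ {v : V | v ∉ ({a, b} : Finset V)} := by simp [hva, hvb]
  obtain ⟨p⟩ := hconn.preconnected ⟨u, hu'⟩ ⟨v, hv'⟩
  obtain ⟨d, -, h1, h2⟩ := p.exists_boundary_dart {x | x.1 ∈ S} hu hv
  have hi := d.fst.2
  have hj := d.snd.2
  simp only [Set.mem_ofPred_eq, Finset.mem_insert, Finset.mem_singleton, not_or] at hi hj
  exact ⟨d.fst.1, d.snd.1, h1, h2, hi.1, hi.2, hj.1, hj.2, d.adj⟩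

namespace BracedPolygonGraph

/-- If the polygon stays `3`-connected without the braces in `B`, it has a strictly convex
realisation with a stress that is positive on the boundary and on `B` and negative on the other
braces. -/
theorem exists_isStrictlyConvexPolygon_stress {n : ℕ} (P : BracedPolygonGraph n)
    (B : Set (Sym2 (Fin n))) (hB : B ⊆ P.braces)
    (hconn : IsKConnected 3 (P.deleteBraces B hB).graph) :
    ∃ p : Fin n → EuclideanSpace ℝ (Fin 2), IsStrictlyConvexPolygon p ∧
      ∃ ω : Sym2 (Fin n) → ℝ, IsEquilibriumStress P.graph p ω ∧
        (P.deleteBraces B hB).HasProperSigns ω ∧ ∀ e ∈ B, 0 < ω e := by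
  classical
  obtain ⟨M, rfl⟩ : ∃ M, n = M + 1 := ⟨n - 1, by have := P.three_le; omega⟩
  have hM3 : 3 ≤ M := by
    have := hconn.1
    rw [Fintype.card_fin] at this
    omega
  have hM : 2 ≤ M := by omega
  set Q := P.deleteBraces B hB with hQ
  let w₀ : Fin (M + 1) → Fin (M + 1) → ℝ := fun i j => if s(i, j) ∈ Q.braces then 1 else 0
  let w₁ : Fin (M + 1) → Fin (M + 1) → ℝ := fun i j => if s(i, j) ∈ B then 1 else 0
  have hw₀ : ∀ i j, w₀ i j = w₀ j i := fun i j => by simp only [w₀, Sym2.eq_swap]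
  have hw₁ : ∀ i j, w₁ i j = w₁ j i := fun i j => by simp only [w₁, Sym2.eq_swap]
  have hw0 : ∀ i j, 0 ≤ w₀ i j := fun i j => by
    simp only [w₀]
    split_ifs <;> norm_num
  have hpos : ∀ i j, Q.graph.Adj i j → ¬ (SimpleGraph.cycleGraph (M + 1)).Adj i j → 0 < w₀ i j := by
    intro i j h1 h2
    simp only [w₀]
    rw [if_pos ⟨h1, h2⟩]
    exact one_pos
  have hcross : ∀ a u b : Fin (M + 1), a < u → u < b → ((a : ℕ) ≠ 0 ∨ (b : ℕ) ≠ M) →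
      ∃ i j, a < i ∧ i < b ∧ (j < a ∨ b < j) ∧ 0 < w₀ i j := by
    intro a u b hau hub hab
    have hb := b.isLt
    obtain ⟨v, hv⟩ : ∃ v, v < a ∨ b < v := by
      rcases hab with h | h
      · exact ⟨⟨0, by omega⟩, Or.inl (Fin.lt_def.2 (Nat.pos_of_ne_zero h))⟩
      · exact ⟨⟨M, by omega⟩, Or.inr (Fin.lt_def.2 (by simp only; omega))⟩
    obtain ⟨i, j, hi, hj, -, -, hja, hjb, hadj⟩ := hconn.exists_adj_of_two a b (Set.Ioo a b)
      (u := u) (v := v) ⟨hau, hub⟩ (fun h => by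
        rcases hv with h' | h'
        · exact lt_asymm h.1 h'
        · exact lt_asymm h.2 h') hau.ne' hub.ne
      (by rintro rfl; rcases hv with h | h
          · exact lt_irrefl _ h
          · exact lt_asymm h (hau.trans hub))
      (by rintro rfl; rcases hv with h | h
          · exact lt_asymm h (hau.trans hub)
          · exact lt_irrefl _ h)
    have hj' : j < a ∨ b < j := by
      by_contra! h
      exact hj ⟨lt_of_le_of_ne h.1 hja.symm, lt_of_le_of_ne h.2 hjb⟩
    refine ⟨i, j, hi.1, hi.2, hj', hpos i j hadj ?_⟩
    rw [cycleGraph_adj_iff_val hM]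
    have h1 : (a : ℕ) < i := hi.1
    have h2 : (i : ℕ) < b := hi.2
    have h3 : (j : ℕ) < a ∨ (b : ℕ) < j := hj'
    omega
  have hdeg : ∀ i, ∃ j, j ≠ i ∧ ¬ (SimpleGraph.cycleGraph (M + 1)).Adj i j ∧ 0 < w₀ i j := by
    intro i
    obtain ⟨a, b, -, hia, hib, hnb⟩ := exists_cycleGraph_neighbours hM i
    obtain ⟨v, hv⟩ : ∃ v, v ∉ ({i, a, b} : Finset (Fin (M + 1))) := by
      by_contra! h
      have h1 : (Finset.univ : Finset (Fin (M + 1))) ⊆ {i, a, b} := fun x _ => h x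
      have h2 := (Finset.card_le_card h1).trans Finset.card_le_three
      rw [Finset.card_univ, Fintype.card_fin] at h2
      omega
    simp only [Finset.mem_insert, Finset.mem_singleton, not_or] at hv
    obtain ⟨x, j, hx, hj, -, -, hja, hjb, hadj⟩ := hconn.exists_adj_of_two a b {i}
      (u := i) (v := v) rfl hv.1 hia.ne hib.ne hv.2.1 hv.2.2
    rw [Set.mem_singleton_iff] at hx hj
    subst hx
    have hnadj : ¬ (SimpleGraph.cycleGraph (M + 1)).Adj x j := fun h =>
      (hnb j h).elim hja hjb
    exact ⟨j, hj, hnadj, hpos x j hadj hnadj⟩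
  obtain ⟨η, hη, θ, hθ, hmax, hs, hout⟩ :=
    exists_isMaxOn_perturbedWeights hM w₁ hw₀ hw0 hcross hdeg
  set w := perturbedWeights w₀ w₁ η with hwdef
  have hw : ∀ i j, w i j = w j i := fun i j => by
    simp only [hwdef, perturbedWeights]
    rw [hw₀, hw₁]
  obtain ⟨c, d, hbal⟩ := exists_cycleStress_of_isMaxOn hM hθ hs hw hmax
  let ω : Sym2 (Fin (M + 1)) → ℝ :=
    Sym2.lift ⟨fun i j => cycleStress c d i j - w i j, fun i j =>
      congrArg₂ (· - ·) (cycleStress_comm c d i j) (hw i j)⟩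
  have hω : ∀ i j, ω s(i, j) = cycleStress c d i j - w i j := fun i j => rfl
  have hw₀' : ∀ {i j}, s(i, j) ∉ Q.braces → w₀ i j = 0 := fun h => if_neg h
  have hw₁' : ∀ {i j}, s(i, j) ∉ B → w₁ i j = 0 := fun h => if_neg h
  have hQP : Q.graph.edgeSet = P.graph.edgeSet \ B := SimpleGraph.edgeSet_deleteEdges B
  refine ⟨chainPoint θ, isStrictlyConvexPolygon_of_orient_pos hM fun _ _ _ h1 h2 =>
    orient_chainPoint_pos hs (mem_Ioo_of_mem_chainSpace hθ) h1 h2, ω, ⟨?_, ?_⟩, ⟨?_, ?_⟩, ?_⟩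
  · intro e
    induction e using Sym2.ind with
    | _ i j =>
      intro he
      have h1 : ¬ (SimpleGraph.cycleGraph (M + 1)).Adj i j := fun h => he (P.cycle_le h)
      have h2 : s(i, j) ∉ Q.braces := fun h => he (hQP ▸ h.1 : _ ∈ P.graph.edgeSet \ B).1
      have h3 : s(i, j) ∉ B := fun h => he (hB h).1
      rw [hω, cycleStress_eq_zero hM c d h1, hwdef, perturbedWeights, hw₀' h2, hw₁' h3]
      ring
  · intro i
    have hX : ∑ j, ω s(i, j) * (chainX θ i - chainX θ j) = 0 := by
      simp only [hω, sub_mul, Finset.sum_sub_distrib, (hbal i).1, forceX, sub_self]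
    have hY : ∑ j, ω s(i, j) * (chainY θ i - chainY θ j) = 0 := by
      simp only [hω, sub_mul, Finset.sum_sub_distrib, (hbal i).2, forceY, sub_self]
    ext m
    fin_cases m
    · simpa [chainPoint] using hX
    · simpa [chainPoint] using hY
  · intro e
    induction e using Sym2.ind with
    | _ i j =>
      intro he
      have h1 : (SimpleGraph.cycleGraph (M + 1)).Adj i j := he
      have h2 : s(i, j) ∉ Q.braces := fun h => h.2 he
      have h3 : s(i, j) ∉ B := fun h => (hB h).2 he
      rw [hω, hwdef, perturbedWeights, hw₀' h2, hw₁' h3]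
      have := cycleStress_pos hM hout hbal h1
      linarith
  · intro e
    induction e using Sym2.ind with
    | _ i j =>
      intro he
      have h1 : ¬ (SimpleGraph.cycleGraph (M + 1)).Adj i j := he.2
      have h3 : s(i, j) ∉ B := (hQP ▸ he.1 : _ ∈ P.graph.edgeSet \ B).2
      have h4 : w₀ i j = 1 := if_pos he
      rw [hω, hwdef, perturbedWeights, cycleStress_eq_zero hM c d h1, h4, hw₁' h3]
      norm_num
  · intro e
    induction e using Sym2.ind with
    | _ i j =>
      intro he
      have h1 : ¬ (SimpleGraph.cycleGraph (M + 1)).Adj i j := (hB he).2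
      have h2 : s(i, j) ∉ Q.braces := fun h => (hQP ▸ h.1 : _ ∈ P.graph.edgeSet \ B).2 he
      have h4 : w₁ i j = 1 := if_pos he
      rw [hω, hwdef, perturbedWeights, cycleStress_eq_zero hM c d h1, hw₀' h2, h4]
      linarith

end BracedPolygonGraph

theorem mainTheorem3 {n : ℕ} (P : BracedPolygonGraph n) (hP : IsKConnected 3 P.graph) :
    (∃ p : Fin n → EuclideanSpace ℝ (Fin 2),
      IsStrictlyConvexPolygon p ∧ P.IsProperlyStressed p) ∧
    ∀ (B : Set (Sym2 (Fin n))) (hB : B ⊆ P.braces),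
      IsKConnected 3 (P.deleteBraces B hB).graph →
      ∃ p : Fin n → EuclideanSpace ℝ (Fin 2), IsStrictlyConvexPolygon p ∧
        ∃ ω : Sym2 (Fin n) → ℝ, IsEquilibriumStress P.graph p ω ∧
          (P.deleteBraces B hB).HasProperSigns ω ∧ ∀ e ∈ B, 0 < ω e := by
  refine ⟨?_, fun B hB hconn => P.exists_isStrictlyConvexPolygon_stress B hB hconn⟩
  have hgraph : (P.deleteBraces ∅ (Set.empty_subset _)).graph = P.graph :=
    SimpleGraph.deleteEdges_empty
  obtain ⟨p, hp, ω, hω, hsign, -⟩ := P.exists_isStrictlyConvexPolygon_stress ∅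
    (Set.empty_subset _) (by rw [hgraph]; exact hP)
  refine ⟨p, hp, ω, hω, hsign.1, fun e he => hsign.2 e ⟨?_, he.2⟩⟩
  rw [hgraph]
  exact he.1
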